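/- Let $\Omega\subset\mathbb R$ be a measurable set of finite Lebesgue measure (for instance a bounded one), write $\widehat f(\xi)=\mathcal F f(\xi)=\int_{\mathbb R} f(x)e^{-2\pi i x\xi}\,dx$ for the Fourier transform (extended to $L_2(\mathbb R)$ and to tempered distributions), put $K:=\mathcal F^{-1}\chi_\Omega$, and assume that $K\in L_p(\mathbb R)$ for all $1<p<\infty$. Consider the Hilbert space $\mathcal H=B_\Omega^2=\{f\in L_2(\mathbb R): \widehat f=0\text{ a.e. on }\mathbb R\setminus\Omega\}$ with the $L_2$ inner product, the unitary representation $\pi(x)f=f(\cdot-x)$ of $\mathbb R$ on $\mathcal H$, the vector $u:=K\in\mathcal H$ and the voice transform $Vv(x)=\langle v,\pi(x)u\rangle_{L_2}$. Let $\mathcal S=\{v\in\mathcal H: Vv\in L_p(\mathbb R)\text{ for all }1<p<\infty\}$ be the test space with the locally convex topology generated by the seminorms $v\mapsto\|Vv\|_{L_p}$, $1<p<\infty$; let $\mathcal S'$ be the space of continuous antilinear functionals on $\mathcal S$, let $V_e\varphi(x)=\langle\varphi,\pi(x)u\rangle_{\mathcal S}$ for $\varphi\in\mathcal S'$, and let $\operatorname{Co}(L_p)=\{\varphi\in\mathcal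 S': V_e\varphi\in L_p(\mathbb R)\}$ with norm $\|\varphi\|_{\operatorname{Co}(L_p)}=\|V_e\varphi\|_{L_p}$. Functions are identified if they agree almost everywhere. Then the following hold. 1. With $\mathcal T:=\bigcap_{1<p<\infty}L_p(\mathbb R)$ we have $\mathcal S=\{f\in\mathcal T: f*K=f\}$, and the topology of $\mathcal S$ is generated by the norms $(\|\cdot\|_{L_p})_{1<p<\infty}$. 2. Let $\mathcal M_p=\{f\in L_p(\mathbb R): f*K=f\}$ and $\mathcal M=\bigcup_{1<p<\infty}\mathcal M_p$. The map $\iota:\mathcal M\to\mathcal S'$, $f\mapsto\Phi_f$ with $\langle\Phi_f,g\rangle_{\mathcal S}=\langle f,g\rangle_{L_2}=\int_{\mathbb R} f(x)\overline{g(x)}\,dx$ (an absolutely convergent integral), is well defined and a bijection. 3. If $\varphi\in\mathcal S'$ is identified with $\iota^{-1}\varphi\in\mathcal M$, the extended voice transform is the identity: $V_e\varphi=\iota^{-1}\varphi$ for all $\varphi\in\mathcal S'$. 4. For all $p\in(1,\infty)$ we have $\operatorname{Co}(L_p)=\iota(\mathcal M_p)$, and $\|\iota f\|_{\operatorname{Co}(L_p)}=\|f\|_{L_p}$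 for $f\in\mathcal M_p$. 5. For all $p\in(1,2]$ we have $\mathcal M_p=B_\Omega^p:=\{f\in L_p(\mathbb R): \widehat f=0\text{ a.e. on }\mathbb R\setminus\Omega\}$. Thus, up to the identification above, $\operatorname{Co}(L_p)=B_\Omega^p$ for these $p$. -/

import Mathlib

open MeasureTheory FourierTransform SchwartzMap
open scoped ENNReal ComplexConjugate

namespace Coorbit

noncomputable section

/-- The exponents `1 < p < ∞`. -/
abbrev Exponent : Type := {p : ℝ≥0∞ // 1 < p ∧ p < ⊤}

instance : Nonempty Exponent := ⟨⟨2, by norm_num, by norm_num⟩⟩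

/-! ### Coorbit theory on the group `ℝ` with the trivial weight `w = 1` -/

section General

variable {H : Type*} [NormedAddCommGroup H] [InnerProductSpace ℂ H]

/-- The voice transform `V v (x) = ⟨v, π(x) u⟩`.
Mathlib's inner product is antilinear in the first slot, hence the order of the arguments. -/
def voice (π : Multiplicative ℝ →* (H ≃ₗᵢ[ℂ] H)) (u v : H) (x : ℝ) : ℂ :=
  inner ℂ (π (Multiplicative.ofAdd x) u) v

/-- The set of all `v` in `H` such that `V v ∈ L_p` for all `1 < p < ∞`, as a linear subspace. -/
def testSubmodule (π : Multiplicative ℝ →* (H ≃ₗᵢ[ℂ] H)) (u : H) : Submodule ℂ H where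
  carrier := {v | ∀ p : Exponent, MemLp (voice π u v) p volume}
  zero_mem' := by
    intro p
    have h : voice π u (0 : H) = 0 := by
      funext x
      simp [voice]
    rw [h]
    exact MemLp.zero
  add_mem' := by
    intro a b ha hb p
    have h : voice π u (a + b) = voice π u a + voice π u b := by
      funext x
      exact inner_add_right _ _ _
    rw [h]
    exact (ha p).add (hb p)
  smul_mem' := by
    intro c a ha p
    have h : voice π u (c • a) = c • voice π u a := by
      funext x
      exact inner_smul_right _ _ _
    rw [h]
    exact (ha p).const_smul c

/-- The test space `S`. This is a type of its own because its topology is not the one induced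
from `H`, see below. -/
def TestSpace (π : Multiplicative ℝ →* (H ≃ₗᵢ[ℂ] H)) (u : H) : Type _ := ↥(testSubmodule π u)

instance (π : Multiplicative ℝ →* (H ≃ₗᵢ[ℂ] H)) (u : H) : AddCommGroup (TestSpace π u) :=
  inferInstanceAs (AddCommGroup ↥(testSubmodule π u))

instance (π : Multiplicative ℝ →* (H ≃ₗᵢ[ℂ] H)) (u : H) : Module ℂ (TestSpace π u) :=
  inferInstanceAs (Module ℂ ↥(testSubmodule π u))

/-- A test vector, as an element of the Hilbert space. -/
def TestSpace.val {π : Multiplicative ℝ →* (H ≃ₗᵢ[ℂ] H)} {u : H} (v : TestSpace π u) : H :=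
  Subtype.val (p := fun x => x ∈ testSubmodule π u) v

/-- The seminorms `v ↦ ‖V v‖_{L_p}`, `1 < p < ∞`, on the test space. -/
def testSeminorm (π : Multiplicative ℝ →* (H ≃ₗᵢ[ℂ] H)) (u : H) :
    SeminormFamily ℂ (TestSpace π u) Exponent := fun p =>
  Seminorm.of (fun v => (eLpNorm (voice π u v.val) p volume).toReal)
    (by
      intro a b
      have h : voice π u (a + b).val = voice π u a.val + voice π u b.val := by
        funext x
        exact inner_add_right _ _ _
      have ha : MemLp (voice π u a.val) p volume := a.2 p
      have hb : MemLp (voice π u b.val) p volume := b.2 p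
      rw [h, ← ENNReal.toReal_add ha.2.ne hb.2.ne]
      exact ENNReal.toReal_mono (ENNReal.add_ne_top.2 ⟨ha.2.ne, hb.2.ne⟩)
        (eLpNorm_add_le ha.1 hb.1 p.2.1.le))
    (by
      intro c a
      have h : voice π u (c • a).val = c • voice π u a.val := by
        funext x
        exact inner_smul_right _ _ _
      rw [h, eLpNorm_const_smul, ENNReal.toReal_mul]
      simp)

/-- The locally convex topology of the test space, generated by the seminorms above. -/
instance (π : Multiplicative ℝ →* (H ≃ₗᵢ[ℂ] H)) (u : H) : TopologicalSpace (TestSpace π u) :=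
  (testSeminorm π u).moduleFilterBasis.topology

/-- The antidual `S'`: the continuous antilinear functionals on the test space. -/
abbrev AntiDual (π : Multiplicative ℝ →* (H ≃ₗᵢ[ℂ] H)) (u : H) : Type _ :=
  TestSpace π u →L⋆[ℂ] ℂ

/-- The integrability of the kernel: `K = V u ∈ L_p` for all `1 < p < ∞`. -/
def Admissible (π : Multiplicative ℝ →* (H ≃ₗᵢ[ℂ] H)) (u : H) : Prop :=
  ∀ p : Exponent, MemLp (voice π u u) p volume

theorem voice_orbit (π : Multiplicative ℝ →* (H ≃ₗᵢ[ℂ] H)) (u : H) (x y : ℝ) :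
    voice π u (π (Multiplicative.ofAdd x) u) y = voice π u u (y - x) := by
  have h : π (Multiplicative.ofAdd y) u
      = π (Multiplicative.ofAdd x) (π (Multiplicative.ofAdd (y - x)) u) := by
    have h' : π (Multiplicative.ofAdd y)
        = π (Multiplicative.ofAdd x) * π (Multiplicative.ofAdd (y - x)) := by
      rw [← map_mul, ← ofAdd_add, add_sub_cancel]
    rw [h']
    rfl
  rw [voice, h, LinearIsometryEquiv.inner_map_map, voice]

/-- The vector `π(x) u`, as an element of the test space. -/
def orbit (π : Multiplicative ℝ →* (H ≃ₗᵢ[ℂ] H)) (u : H) (hK : Admissible π u) (x : ℝ) :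
    TestSpace π u :=
  ⟨π (Multiplicative.ofAdd x) u, by
    intro p
    have h : voice π u (π (Multiplicative.ofAdd x) u) = voice π u u ∘ fun y => y - x := by
      funext y
      exact voice_orbit π u x y
    rw [h]
    exact (hK p).comp_measurePreserving (measurePreserving_sub_right volume x)⟩

/-- The extended voice transform `V_e T (x) = ⟨T, π(x) u⟩` of `T ∈ S'`. -/
def extVoice {π : Multiplicative ℝ →* (H ≃ₗᵢ[ℂ] H)} {u : H} (hK : Admissible π u)
    (T : AntiDual π u) (x : ℝ) : ℂ :=
  T (orbit π u hK x)

/-- The coorbit space `Co(L_p) = {T ∈ S' | V_e T ∈ L_p}`. -/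
def coorbit {π : Multiplicative ℝ →* (H ≃ₗᵢ[ℂ] H)} {u : H} (hK : Admissible π u)
    (p : Exponent) : Set (AntiDual π u) :=
  {T | MemLp (extVoice hK T) p volume}

/-- The coorbit norm `‖T‖_{Co(L_p)} = ‖V_e T‖_{L_p}`. -/
def coorbitNorm {π : Multiplicative ℝ →* (H ≃ₗᵢ[ℂ] H)} {u : H} (hK : Admissible π u)
    (p : Exponent) (T : AntiDual π u) : ℝ :=
  (eLpNorm (extVoice hK T) p volume).toReal

end General

/-! ### Function spaces on `ℝ` (functions are identified when they agree almost everywhere) -/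

/-- `T = ⋂_{1 < p < ∞} L_p(ℝ)`. -/
def targetSpace : Set (ℝ →ₘ[volume] ℂ) := {f | ∀ p : Exponent, MemLp f p volume}

/-- `f * K = f`, where the convolution integral converges absolutely almost everywhere. -/
def Reproduced (K : ℝ → ℂ) (f : ℝ →ₘ[volume] ℂ) : Prop :=
  (∀ᵐ x, ConvolutionExistsAt f K x (ContinuousLinearMap.mul ℂ ℂ) volume) ∧
    convolution f K (ContinuousLinearMap.mul ℂ ℂ) volume =ᵐ[volume] f

/-- `M_p = {f ∈ L_p(ℝ) | f * K = f}`. -/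
def reproducingSpace (K : ℝ → ℂ) (p : Exponent) : Set (ℝ →ₘ[volume] ℂ) :=
  {f | MemLp f p volume ∧ Reproduced K f}

/-- `M = ⋃_{1 < p < ∞} M_p`. -/
def reproducingUnion (K : ℝ → ℂ) : Set (ℝ →ₘ[volume] ℂ) := ⋃ p : Exponent, reproducingSpace K p

/-- The Fourier transform of `f`, as a tempered distribution, is the function `g`. -/
def IsFourierTransform (f g : ℝ → ℂ) : Prop :=
  LocallyIntegrable g volume ∧
    ∀ φ : 𝓢(ℝ, ℂ), Integrable (fun ξ => φ ξ * g ξ) volume ∧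
      ∫ x, 𝓕 φ x * f x = ∫ ξ, φ ξ * g ξ

/-- The Paley-Wiener space `B^p_Ω` for `1 < p ≤ 2`: all `f ∈ L_p(ℝ)` whose Fourier transform
(which is a function for these exponents) vanishes almost everywhere outside of `Ω`. -/
def paleyWiener (Ω : Set ℝ) (p : Exponent) : Set (ℝ →ₘ[volume] ℂ) :=
  {f | MemLp f p volume ∧ ∃ g : ℝ → ℂ, IsFourierTransform f g ∧ ∀ᵐ ξ, ξ ∉ Ω → g ξ = 0}

/-! ### The Paley-Wiener representation -/

/-- The Hilbert space `B^2_Ω` with the inner product of `L_2(ℝ)`; here `𝓕` is the Fourier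
transform on `L_2(ℝ)`. -/
def PWHilbert (Ω : Set ℝ) : Submodule ℂ (Lp ℂ 2 (volume : Measure ℝ)) where
  carrier := {f | ∀ᵐ ξ, ξ ∉ Ω → (𝓕 f : Lp ℂ 2 (volume : Measure ℝ)) ξ = 0}
  zero_mem' := by
    have h : (𝓕 (0 : Lp ℂ 2 (volume : Measure ℝ)) : Lp ℂ 2 (volume : Measure ℝ)) = 0 :=
      (Lp.fourierTransformₗᵢ ℝ ℂ).map_zero
    rw [Set.mem_ofPred_eq, h]
    filter_upwards [Lp.coeFn_zero ℂ 2 (volume : Measure ℝ)] with ξ hξ _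
    exact hξ
  add_mem' := by
    intro a b ha hb
    have h : (𝓕 (a + b) : Lp ℂ 2 (volume : Measure ℝ)) = 𝓕 a + 𝓕 b :=
      (Lp.fourierTransformₗᵢ ℝ ℂ).map_add a b
    rw [Set.mem_ofPred_eq] at ha hb ⊢
    rw [h]
    filter_upwards [ha, hb, Lp.coeFn_add (𝓕 a) (𝓕 b)] with ξ h1 h2 h3 hξ
    rw [h3, Pi.add_apply, h1 hξ, h2 hξ, add_zero]
  smul_mem' := by
    intro c a ha
    have h : (𝓕 (c • a) : Lp ℂ 2 (volume : Measure ℝ)) = c • 𝓕 a :=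
      (Lp.fourierTransformₗᵢ ℝ ℂ).map_smul c a
    rw [Set.mem_ofPred_eq] at ha ⊢
    rw [h]
    filter_upwards [ha, Lp.coeFn_smul c (𝓕 a)] with ξ h1 h3 hξ
    rw [h3, Pi.smul_apply, h1 hξ, smul_zero]

/-- Translation `f ↦ f(· - x)` on `L_2(ℝ)`. -/
def translate (x : ℝ) : Lp ℂ 2 (volume : Measure ℝ) →ₗᵢ[ℂ] Lp ℂ 2 (volume : Measure ℝ) :=
  Lp.compMeasurePreservingₗᵢ ℂ (fun y => y - x) (measurePreserving_sub_right volume x)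

theorem translate_coeFn (x : ℝ) (f : Lp ℂ 2 (volume : Measure ℝ)) :
    translate x f =ᵐ[volume] fun y => f (y - x) :=
  Lp.coeFn_compMeasurePreserving f (measurePreserving_sub_right volume x)

theorem translate_zero (f : Lp ℂ 2 (volume : Measure ℝ)) : translate 0 f = f := by
  apply Lp.ext
  filter_upwards [translate_coeFn 0 f] with y h
  rw [h, sub_zero]

theorem translate_add (x y : ℝ) (f : Lp ℂ 2 (volume : Measure ℝ)) :
    translate (x + y) f = translate x (translate y f) := by
  apply Lp.ext
  have h := (measurePreserving_sub_right (volume : Measure ℝ) x).quasiMeasurePreserving.ae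
    (translate_coeFn y f)
  filter_upwards [translate_coeFn (x + y) f, translate_coeFn x (translate y f), h] with z h1 h2 h3
  rw [h1, h2, h3]
  congr 1
  ring

theorem fourier_translate (x : ℝ) (f : Lp ℂ 2 (volume : Measure ℝ)) :
    (𝓕 (translate x f) : Lp ℂ 2 (volume : Measure ℝ)) =ᵐ[volume]
      fun ξ => (Real.fourierChar (-(x * ξ)) : ℂ) * (𝓕 f : Lp ℂ 2 (volume : Measure ℝ)) ξ := by
  have hmem : MemLp (fun ξ => (Real.fourierChar (-(x * ξ)) : ℂ) *
      (𝓕 f : Lp ℂ 2 (volume : Measure ℝ)) ξ) 2 volume := by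
    refine (Lp.memLp (𝓕 f : Lp ℂ 2 (volume : Measure ℝ))).congr_norm ?_ ?_
    · refine AEStronglyMeasurable.mul ?_ (Lp.aestronglyMeasurable _)
      refine Continuous.aestronglyMeasurable ?_
      have := Real.continuous_fourierChar
      fun_prop
    · filter_upwards with ξ
      rw [norm_mul, Circle.norm_coe, one_mul]
  have key : (𝓕 (translate x f) : Lp ℂ 2 (volume : Measure ℝ)) = hmem.toLp _ := by
    have hinj := LinearMap.ker_eq_bot.1
      (Lp.ker_toTemperedDistributionCLM_eq_bot (E := ℝ) (F := ℂ) (μ := volume) (p := 2))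
    apply hinj
    ext φ
    simp only [ContinuousLinearMap.coe_coe, Lp.toTemperedDistributionCLM_apply]
    rw [← Lp.fourier_toTemperedDistribution_eq, TemperedDistribution.fourier_apply,
      Lp.toTemperedDistribution_apply, Lp.toTemperedDistribution_apply]
    set ψ : 𝓢(ℝ, ℂ) := 𝓕⁻ ((𝓕 φ).compSubConstCLM ℂ (-x)) with hψ
    have hψ1 : ∀ y, 𝓕 ψ y = 𝓕 φ (y + x) := by
      intro y
      rw [hψ, fourier_fourierInv_eq, compSubConstCLM_apply, sub_neg_eq_add]
    have hψ2 : ∀ ξ, ψ ξ = (Real.fourierChar (-(x * ξ)) : ℂ) * φ ξ := by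
      intro ξ
      have h1 : φ ξ = 𝓕⁻ (⇑(𝓕 φ : 𝓢(ℝ, ℂ))) ξ := by
        have : (𝓕⁻ (𝓕 φ) : 𝓢(ℝ, ℂ)) ξ = φ ξ := by rw [fourierInv_fourier_eq]
        rw [← this, fourierInv_coe]
      rw [h1, hψ, fourierInv_coe]
      rw [Real.fourierInv_eq, Real.fourierInv_eq, ← integral_const_mul]
      rw [← integral_sub_right_eq_self _ x]
      congr 1 with y
      simp only [compSubConstCLM_apply, Circle.smul_def, smul_eq_mul]
      rw [← mul_assoc, ← Circle.coe_mul, ← AddChar.map_add_eq_mul]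
      congr 3
      · simp
        ring
      · ring
    have hL : ∫ y, 𝓕 φ y • translate x f y = ∫ y, 𝓕 ψ y • f y := by
      rw [← integral_sub_right_eq_self (fun y => 𝓕 ψ y • f y) x]
      refine integral_congr_ae ?_
      filter_upwards [translate_coeFn x f] with y hy
      rw [hy, hψ1, sub_add_cancel]
    rw [hL, ← Lp.toTemperedDistribution_apply, ← TemperedDistribution.fourier_apply,
      Lp.fourier_toTemperedDistribution_eq, Lp.toTemperedDistribution_apply]
    refine integral_congr_ae ?_
    filter_upwards [hmem.coeFn_toLp] with ξ hξ
    rw [hξ, hψ2]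
    simp only [smul_eq_mul]
    ring
  rw [key]
  exact hmem.coeFn_toLp

theorem translate_mem {Ω : Set ℝ} (x : ℝ) {f : Lp ℂ 2 (volume : Measure ℝ)}
    (hf : f ∈ PWHilbert Ω) : translate x f ∈ PWHilbert Ω := by
  change ∀ᵐ ξ, ξ ∉ Ω → (𝓕 f : Lp ℂ 2 (volume : Measure ℝ)) ξ = 0 at hf
  change ∀ᵐ ξ, ξ ∉ Ω → (𝓕 (translate x f) : Lp ℂ 2 (volume : Measure ℝ)) ξ = 0
  filter_upwards [fourier_translate x f, hf] with ξ h1 h2 hξ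
  rw [h1, h2 hξ, mul_zero]

/-- The unitary operator `f ↦ f(· - x)` on `B^2_Ω`. -/
def translateEquiv (Ω : Set ℝ) (x : ℝ) : PWHilbert Ω ≃ₗᵢ[ℂ] PWHilbert Ω where
  toLinearEquiv := LinearEquiv.ofLinearMap
    (((translate x).toLinearMap).restrict (fun _ hf => translate_mem x hf))
    (((translate (-x)).toLinearMap).restrict (fun _ hf => translate_mem (-x) hf))
    (by
      ext1 f
      refine Subtype.ext ?_
      change translate x (translate (-x) f.1) = f.1
      rw [← translate_add, add_neg_cancel, translate_zero])
    (by
      ext1 f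
      refine Subtype.ext ?_
      change translate (-x) (translate x f.1) = f.1
      rw [← translate_add, neg_add_cancel, translate_zero])
  norm_map' f := (translate x).norm_map f.1

/-- The unitary representation `π(x) f = f(· - x)` of `ℝ` on `B^2_Ω`. -/
def translation (Ω : Set ℝ) : Multiplicative ℝ →* (PWHilbert Ω ≃ₗᵢ[ℂ] PWHilbert Ω) where
  toFun x := translateEquiv Ω x.toAdd
  map_one' := by
    ext1 f
    exact Subtype.ext (translate_zero f.1)
  map_mul' x y := by
    ext1 f
    exact Subtype.ext (translate_add x.toAdd y.toAdd f.1)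

/-- The vector `u = 𝓕⁻ χ_Ω` of `B^2_Ω`. -/
def pwVector {Ω : Set ℝ} (hΩ : MeasurableSet Ω) (hfin : volume Ω ≠ ⊤) : PWHilbert Ω :=
  ⟨𝓕⁻ (indicatorConstLp 2 hΩ hfin (1 : ℂ)), by
    change ∀ᵐ ξ, ξ ∉ Ω → (𝓕 (𝓕⁻ (indicatorConstLp 2 hΩ hfin (1 : ℂ))) :
      Lp ℂ 2 (volume : Measure ℝ)) ξ = 0
    rw [fourier_fourierInv_eq]
    filter_upwards [indicatorConstLp_coeFn_notMem (p := 2) (hs := hΩ) (hμs := hfin)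
      (c := (1 : ℂ))] with ξ h
    exact h⟩

/-- The kernel `K = 𝓕⁻ χ_Ω`, that is, `K(x) = ∫_Ω exp(2πi x ξ) dξ`. -/
def pwKernel (Ω : Set ℝ) : ℝ → ℂ := 𝓕⁻ (Ω.indicator (fun _ => (1 : ℂ)))

/-- `K` is the reproducing kernel `V u` of the representation. -/
theorem voice_pwVector {Ω : Set ℝ} (hΩ : MeasurableSet Ω) (hfin : volume Ω ≠ ⊤) :
    voice (translation Ω) (pwVector hΩ hfin) (pwVector hΩ hfin) = pwKernel Ω := by
  funext x
  set c : Lp ℂ 2 (volume : Measure ℝ) := indicatorConstLp 2 hΩ hfin (1 : ℂ) with hc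
  change inner ℂ (translate x (𝓕⁻ c)) (𝓕⁻ c) = _
  rw [← Lp.inner_fourier_eq, fourier_fourierInv_eq, L2.inner_def, pwKernel, Real.fourierInv_eq]
  refine integral_congr_ae ?_
  have h := fourier_translate x (𝓕⁻ c)
  rw [fourier_fourierInv_eq] at h
  filter_upwards [h, indicatorConstLp_coeFn (p := 2) (hs := hΩ) (hμs := hfin)
    (c := (1 : ℂ))] with ξ h1 h2
  rw [h1, hc, h2]
  by_cases hξ : ξ ∈ Ω
  · simp [hξ, Circle.smul_def, mul_comm, AddChar.map_neg_eq_inv]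
  · simp [hξ]

theorem pw_admissible {Ω : Set ℝ} (hΩ : MeasurableSet Ω) (hfin : volume Ω ≠ ⊤)
    (hK : ∀ p : Exponent, MemLp (pwKernel Ω) p volume) :
    Admissible (translation Ω) (pwVector hΩ hfin) := by
  intro p
  rw [voice_pwVector]
  exact hK p

/-- The test space `S` of the Paley-Wiener representation. -/
abbrev PWTest {Ω : Set ℝ} (hΩ : MeasurableSet Ω) (hfin : volume Ω ≠ ⊤) : Type :=
  TestSpace (translation Ω) (pwVector hΩ hfin)

/-- A test vector as a function on `ℝ` (up to equality almost everywhere). -/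
def PWTest.fn {Ω : Set ℝ} {hΩ : MeasurableSet Ω} {hfin : volume Ω ≠ ⊤} (g : PWTest hΩ hfin) :
    ℝ →ₘ[volume] ℂ :=
  (TestSpace.val (π := translation Ω) (u := pwVector hΩ hfin) g).1.1

end

end Coorbit

/-! On `L_2`, Plancherel turns the pairing of f with π(x)K into the inverse Fourier transform of χ_Ω
· 𝓕f at x. As K(-x) is the conjugate of K(x), this pairing is also (f * K)(x). Hence convolution
with K is the orthogonal projection onto the band-limited functions, the voice transform is the
identity almost everywhere, and K * K = K (`conv_eq_inner`, `conv_pwKernel_ae_eq_iff`,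
`conv_pwKernel_self`). This describes the test space.

K need not be integrable, so Young's inequality does not make convolution with K bounded on `L_p`;
it does map `L_p` to `L_r` for every r > p (`memLp_conv_pwKernel`). The antidual is found through
this gain. A continuous functional T is bounded by finitely many of the norms. If s lies below all
their exponents, these norms of g * K are bounded by the `L_s` norm of g, so g ↦ T(g * K) is
controlled by a single norm (`exists_bound_smooth`). A Gaussian-weighted Riesz argument in `L_2`
represents it by a measurable f (`exists_representation_smooth`), duality puts f into the space
conjugate to `L_s` (`memLp_of_forall_integral_le`), and density extends the formula to test
functions v, for which v * K = v. By symmetry of the convolution, f * K defines the same functional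
and is reproduced (`exists_eq_functional`). The extended voice transform of the functional given by
f is f * K, which is f itself on M; this yields injectivity, the coorbit spaces and their norms.

For p ≤ 2, a reproduced f in `L_p` lies in `L_2`, where reproduction and band limitation agree.
Conversely, if f in `L_p` is band-limited and ψ is a Schwartz function, then f * ψ is in `L_2` with
Fourier transform 𝓕f · 𝓕ψ, hence is reproduced; commuting the convolutions and varying ψ gives f * K
= f. -/

namespace Coorbit

/-! ### Young's inequality -/

/-- Young's inequality for convolutions of nonnegative functions on `ℝ`. -/
theorem lintegral_convolution_rpow_le {F G : ℝ → ℝ≥0∞} (hF : AEMeasurable F volume)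
    (hG : AEMeasurable G volume) {p q r : ℝ} (hp : 0 < p) (hq : 0 < q) (hr : 0 < r)
    (hpr : r⁻¹ ≤ p⁻¹) (hqr : r⁻¹ ≤ q⁻¹) (h : p⁻¹ + q⁻¹ = 1 + r⁻¹) :
    ∫⁻ x, (∫⁻ y, F y * G (x - y)) ^ r ≤
      (∫⁻ y, F y ^ p) ^ (r / p) * (∫⁻ y, G y ^ q) ^ (r / q) := by
  set A := ∫⁻ y, F y ^ p with hA
  set B := ∫⁻ y, G y ^ q with hB
  have hGx : ∀ x : ℝ, AEMeasurable (fun y => G (x - y)) volume := fun x =>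
    hG.comp_quasiMeasurePreserving (Measure.measurePreserving_sub_left volume x).quasiMeasurePreserving
  have hBx : ∀ x : ℝ, ∫⁻ y, G (x - y) ^ q = B := fun x =>
    lintegral_sub_left_eq_self (fun y => G y ^ q) x
  have a0 : 0 ≤ p⁻¹ - r⁻¹ := by linarith
  have b0 : 0 ≤ q⁻¹ - r⁻¹ := by linarith
  have r0 : 0 ≤ r⁻¹ := by positivity
  -- The standard factorization: F G = (F^p G^q)^(1/r) · (F^p)^(1/p - 1/r) · (G^q)^(1/q - 1/r).
  have split : ∀ (t : ℝ≥0∞) (s : ℝ), 0 < s → r⁻¹ ≤ s⁻¹ →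
      (t ^ s) ^ r⁻¹ * (t ^ s) ^ (s⁻¹ - r⁻¹) = t := by
    intro t s hs hrs
    rw [← ENNReal.rpow_add_of_nonneg _ _ r0 (by linarith), ← ENNReal.rpow_mul,
      add_sub_cancel, mul_inv_cancel₀ hs.ne', ENNReal.rpow_one]
  have hold : ∀ x, ∫⁻ y, F y * G (x - y) ≤
      (∫⁻ y, F y ^ p * G (x - y) ^ q) ^ r⁻¹ * (A ^ (p⁻¹ - r⁻¹) * B ^ (q⁻¹ - r⁻¹)) := by
    intro x
    -- Hölder with three factors; the weights 1/r, 1/p - 1/r and 1/q - 1/r add up to 1 by the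
    -- relation between the exponents.
    have := ENNReal.lintegral_prod_norm_pow_le (μ := volume) (Finset.univ : Finset (Fin 3))
      (f := ![fun y => F y ^ p * G (x - y) ^ q, fun y => F y ^ p, fun y => G (x - y) ^ q])
      (p := ![r⁻¹, p⁻¹ - r⁻¹, q⁻¹ - r⁻¹])
      (by
        intro i _
        fin_cases i
        · exact (hF.pow_const p).mul ((hGx x).pow_const q)
        · exact hF.pow_const p
        · exact (hGx x).pow_const q)
      (by simp [Fin.sum_univ_three]; linarith)
      (by
        intro i _
        fin_cases i
        exacts [r0, a0, b0])
    simp only [Fin.prod_univ_three, Matrix.cons_val_zero, Matrix.cons_val_one,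
      Matrix.cons_val_two, Matrix.head_cons, Matrix.tail_cons, hBx x] at this
    rw [mul_assoc] at this
    refine le_trans (lintegral_mono fun y => ?_) this
    rw [ENNReal.mul_rpow_of_nonneg _ _ r0]
    have e1 := split (F y) p hp hpr
    have e2 := split (G (x - y)) q hq hqr
    refine le_of_eq ?_
    calc F y * G (x - y) = ((F y ^ p) ^ r⁻¹ * (F y ^ p) ^ (p⁻¹ - r⁻¹)) *
          ((G (x - y) ^ q) ^ r⁻¹ * (G (x - y) ^ q) ^ (q⁻¹ - r⁻¹)) := by rw [e1, e2]
      _ = _ := by ring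
  have hmeas : AEMeasurable (Function.uncurry fun x y => F y ^ p * G (x - y) ^ q)
      ((volume : Measure ℝ).prod volume) :=
    ((hF.pow_const p).comp_quasiMeasurePreserving Measure.quasiMeasurePreserving_snd).mul
      ((hG.pow_const q).comp_quasiMeasurePreserving (quasiMeasurePreserving_sub_of_right_invariant _ _))
  calc ∫⁻ x, (∫⁻ y, F y * G (x - y)) ^ r
      ≤ ∫⁻ x, (∫⁻ y, F y ^ p * G (x - y) ^ q) * (A ^ (r / p - 1) * B ^ (r / q - 1)) := by
        refine lintegral_mono fun x => ?_
        refine (ENNReal.rpow_le_rpow (hold x) hr.le).trans (le_of_eq ?_)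
        rw [ENNReal.mul_rpow_of_nonneg _ _ hr.le, ENNReal.mul_rpow_of_nonneg _ _ hr.le,
          ← ENNReal.rpow_mul, ← ENNReal.rpow_mul, ← ENNReal.rpow_mul, inv_mul_cancel₀ hr.ne',
          ENNReal.rpow_one]
        congr 3 <;> field_simp
    -- Tonelli and translation invariance evaluate the remaining double integral.
    _ = (A * B) * (A ^ (r / p - 1) * B ^ (r / q - 1)) := by
        rw [lintegral_mul_const'' _ hmeas.lintegral_prod_right, lintegral_lintegral_swap hmeas]
        congr 1
        have : ∀ y, ∫⁻ x, F y ^ p * G (x - y) ^ q = F y ^ p * B := by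
          intro y
          have hGy : AEMeasurable (fun x => G (x - y)) volume := hG.comp_quasiMeasurePreserving
            (measurePreserving_sub_right volume y).quasiMeasurePreserving
          rw [lintegral_const_mul'' _ (hGy.pow_const q), lintegral_sub_right_eq_self (fun x => G x ^ q) y]
        simp_rw [this]
        rw [lintegral_mul_const'' _ (hF.pow_const p)]
    _ = A ^ (r / p) * B ^ (r / q) := by
        have key : ∀ (t : ℝ≥0∞) (s : ℝ), 0 < s → r⁻¹ ≤ s⁻¹ →
            t * t ^ (r / s - 1) = t ^ (r / s) := by
          intro t s hs hrs
          have : 1 ≤ r / s := by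
            rw [le_div_iff₀ hs, one_mul]
            exact (inv_le_inv₀ hr hs).1 hrs
          nth_rewrite 1 [← ENNReal.rpow_one t]
          rw [← ENNReal.rpow_add_of_nonneg _ _ zero_le_one (by linarith), add_sub_cancel]
        rw [← key A p hp hpr, ← key B q hq hqr]
        ring

/-- The convolution `∫ f(y) k(x - y) dy`. -/
noncomputable abbrev conv (f k : ℝ → ℂ) : ℝ → ℂ :=
  MeasureTheory.convolution f k (ContinuousLinearMap.mul ℂ ℂ) volume

theorem conv_def (f k : ℝ → ℂ) (x : ℝ) : conv f k x = ∫ y, f y * k (x - y) := rfl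

/-- The absolute convolution `∫ |f(y)| |k(x - y)| dy`. -/
noncomputable def absConv (f k : ℝ → ℂ) (x : ℝ) : ℝ≥0∞ := ∫⁻ y, ‖f y‖ₑ * ‖k (x - y)‖ₑ

theorem aemeasurable_prod_integrand {f k : ℝ → ℂ} (hf : AEStronglyMeasurable f volume)
    (hk : AEStronglyMeasurable k volume) :
    AEStronglyMeasurable (Function.uncurry fun x y => f y * k (x - y))
      ((volume : Measure ℝ).prod volume) :=
  (hf.comp_quasiMeasurePreserving Measure.quasiMeasurePreserving_snd).mul
    (hk.comp_quasiMeasurePreserving (quasiMeasurePreserving_sub_of_right_invariant _ _))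

theorem aemeasurable_absConv {f k : ℝ → ℂ} (hf : AEStronglyMeasurable f volume)
    (hk : AEStronglyMeasurable k volume) : AEMeasurable (absConv f k) volume := by
  have := (aemeasurable_prod_integrand hf hk).enorm.lintegral_prod_right'
  simp only [Function.uncurry, enorm_mul] at this
  exact this

/-- The relation `1/p + 1/q = 1 + 1/r` between the exponents in Young's inequality. -/
def YoungTriple (p q r : ℝ≥0∞) : Prop := 1 ≤ p ∧ 1 ≤ q ∧ r ≠ ⊤ ∧ p⁻¹ + q⁻¹ = 1 + r⁻¹

/-- Since 1/q ≤ 1, the relation forces 1/p ≥ 1/r, and 1/r > 0 because r is finite; symmetrically for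
q. So p and q are finite too. -/
theorem YoungTriple.facts {p q r : ℝ≥0∞} (h : YoungTriple p q r) :
    p ≠ ⊤ ∧ q ≠ ⊤ ∧ 0 < p.toReal ∧ 0 < q.toReal ∧ 0 < r.toReal ∧
      r.toReal⁻¹ ≤ p.toReal⁻¹ ∧ r.toReal⁻¹ ≤ q.toReal⁻¹ ∧
      p.toReal⁻¹ + q.toReal⁻¹ = 1 + r.toReal⁻¹ := by
  obtain ⟨hp, hq, hr, h⟩ := h
  have hp' : p⁻¹ ≤ 1 := ENNReal.inv_le_one.2 hp
  have hq' : q⁻¹ ≤ 1 := ENNReal.inv_le_one.2 hq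
  have hp'' : p⁻¹ ≠ ⊤ := (hp'.trans_lt ENNReal.one_lt_top).ne
  have hq'' : q⁻¹ ≠ ⊤ := (hq'.trans_lt ENNReal.one_lt_top).ne
  have hr'' : r⁻¹ ≠ ⊤ := by
    intro hr0
    rw [hr0, add_top] at h
    exact ENNReal.add_ne_top.2 ⟨hp'', hq''⟩ h
  have hreal : p.toReal⁻¹ + q.toReal⁻¹ = 1 + r.toReal⁻¹ := by
    have := congrArg ENNReal.toReal h
    rwa [ENNReal.toReal_add hp'' hq'', ENNReal.toReal_add ENNReal.one_ne_top hr'',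
      ENNReal.toReal_inv, ENNReal.toReal_inv, ENNReal.toReal_inv, ENNReal.toReal_one] at this
  have hr0 : 0 < r.toReal := ENNReal.toReal_pos (by rintro rfl; simp at hr'') hr
  have hp1 : p.toReal⁻¹ ≤ 1 := by
    have := ENNReal.toReal_mono ENNReal.one_ne_top hp'
    rwa [ENNReal.toReal_inv, ENNReal.toReal_one] at this
  have hq1 : q.toReal⁻¹ ≤ 1 := by
    have := ENNReal.toReal_mono ENNReal.one_ne_top hq'
    rwa [ENNReal.toReal_inv, ENNReal.toReal_one] at this
  have hri : 0 < r.toReal⁻¹ := by positivity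
  have hpt : 0 < p.toReal⁻¹ := by linarith
  have hqt : 0 < q.toReal⁻¹ := by linarith
  refine ⟨?_, ?_, inv_pos.1 hpt, inv_pos.1 hqt, hr0, by linarith, by linarith, hreal⟩
  · rintro rfl; simp at hpt
  · rintro rfl; simp at hqt

/-- Young's inequality. -/
theorem eLpNorm_absConv_le {f k : ℝ → ℂ} (hf : AEStronglyMeasurable f volume)
    (hk : AEStronglyMeasurable k volume) {p q r : ℝ≥0∞} (h : YoungTriple p q r) :
    eLpNorm (absConv f k) r volume ≤ eLpNorm f p volume * eLpNorm k q volume := by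
  obtain ⟨hpt, hqt, hp, hq, hr, h1, h2, h3⟩ := h.facts
  have hp0 : p ≠ 0 := by rintro rfl; simp at hp
  have hq0 : q ≠ 0 := by rintro rfl; simp at hq
  have hr0 : r ≠ 0 := by rintro rfl; simp at hr
  rw [eLpNorm_eq_lintegral_rpow_enorm_toReal hp0 hpt, eLpNorm_eq_lintegral_rpow_enorm_toReal hq0 hqt,
    eLpNorm_eq_lintegral_rpow_enorm_toReal hr0 h.2.2.1]
  have := lintegral_convolution_rpow_le hf.enorm hk.enorm hp hq hr h1 h2 h3
  have := ENNReal.rpow_le_rpow this (z := 1 / r.toReal) (by positivity)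
  rw [ENNReal.mul_rpow_of_nonneg _ _ (by positivity), ← ENNReal.rpow_mul, ← ENNReal.rpow_mul]
    at this
  have e1 : r.toReal / p.toReal * (1 / r.toReal) = 1 / p.toReal := by field_simp
  have e2 : r.toReal / q.toReal * (1 / r.toReal) = 1 / q.toReal := by field_simp
  rw [e1, e2] at this
  simpa [absConv] using this

theorem enorm_convolution_le_absConv (f k : ℝ → ℂ) (x : ℝ) :
    ‖conv f k x‖ₑ ≤ absConv f k x := by
  rw [conv_def]
  refine (enorm_integral_le_lintegral_enorm _).trans (le_of_eq ?_)
  simp [absConv]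

theorem aestronglyMeasurable_convolution {f k : ℝ → ℂ} (hf : AEStronglyMeasurable f volume)
    (hk : AEStronglyMeasurable k volume) :
    AEStronglyMeasurable (conv f k) volume := by
  have := (aemeasurable_prod_integrand hf hk).integral_prod_right'
  exact this

theorem eLpNorm_convolution_le {f k : ℝ → ℂ} (hf : AEStronglyMeasurable f volume)
    (hk : AEStronglyMeasurable k volume) {p q r : ℝ≥0∞} (h : YoungTriple p q r) :
    eLpNorm (conv f k) r volume ≤
      eLpNorm f p volume * eLpNorm k q volume :=
  (eLpNorm_mono_enorm fun x => enorm_convolution_le_absConv f k x).trans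
    (eLpNorm_absConv_le hf hk h)

theorem memLp_convolution {f k : ℝ → ℂ} {p q r : ℝ≥0∞} (h : YoungTriple p q r)
    (hf : MemLp f p volume) (hk : MemLp k q volume) :
    MemLp (conv f k) r volume :=
  ⟨aestronglyMeasurable_convolution hf.1 hk.1, (eLpNorm_convolution_le hf.1 hk.1 h).trans_lt
    (ENNReal.mul_lt_top hf.2 hk.2)⟩

theorem memLp_sub_left {k : ℝ → ℂ} {q : ℝ≥0∞} (hk : MemLp k q volume) (x : ℝ) :
    MemLp (fun y => k (x - y)) q volume :=
  hk.comp_measurePreserving (Measure.measurePreserving_sub_left volume x)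

theorem convolutionExistsAt_of_memLp {f k : ℝ → ℂ} {p q : ℝ≥0∞} [p.HolderConjugate q]
    (hf : MemLp f p volume) (hk : MemLp k q volume) (x : ℝ) :
    ConvolutionExistsAt f k x (ContinuousLinearMap.mul ℂ ℂ) volume :=
  hf.integrable_mul (memLp_sub_left hk x)

/-- The adjoint of a convolution operator, by Fubini's theorem. -/
theorem integral_convolution_mul {f k h : ℝ → ℂ} {p q r r' : ℝ≥0∞} (hpqr : YoungTriple p q r)
    [r.HolderConjugate r'] (hr' : r' ≠ ⊤) (hf : MemLp f p volume) (hk : MemLp k q volume)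
    (hh : MemLp h r' volume) :
    ∫ x, conv f k x * h x =
      ∫ y, f y * ∫ x, k (x - y) * h x := by
  have hm : AEStronglyMeasurable (Function.uncurry fun x y => f y * k (x - y) * h x)
      ((volume : Measure ℝ).prod volume) :=
    (aemeasurable_prod_integrand hf.1 hk.1).mul
      (hh.1.comp_quasiMeasurePreserving Measure.quasiMeasurePreserving_fst)
  -- By Tonelli the absolute double integral is the pairing of `absConv f k`, which is in `L_r` by
  -- Young, with |h| in the conjugate space.
  have hint : Integrable (Function.uncurry fun x y => f y * k (x - y) * h x)
      ((volume : Measure ℝ).prod volume) := by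
    refine ⟨hm, ?_⟩
    rw [HasFiniteIntegral, lintegral_prod _ hm.enorm]
    have e : ∀ x, ∫⁻ y, ‖Function.uncurry (fun x y => f y * k (x - y) * h x) (x, y)‖ₑ
        = absConv f k x * ‖h x‖ₑ := by
      intro x
      simp only [Function.uncurry, enorm_mul, absConv]
      rw [lintegral_mul_const' _ _ enorm_ne_top]
    simp_rw [e]
    obtain ⟨-, -, -, -, hr, -⟩ := hpqr.facts
    have hr0 : r ≠ 0 := by rintro rfl; simp at hr
    have hr0' : r' ≠ 0 := ENNReal.HolderConjugate.ne_zero r' r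
    refine (ENNReal.lintegral_mul_le_Lp_mul_Lq (volume : Measure ℝ)
      (ENNReal.HolderConjugate.toReal_of_ne_top (p := r) (q := r') hpqr.2.2.1 hr')
      (aemeasurable_absConv hf.1 hk.1) hh.1.enorm).trans_lt ?_
    have h1 := (eLpNorm_absConv_le hf.1 hk.1 hpqr).trans_lt (ENNReal.mul_lt_top hf.2 hk.2)
    have h2 := hh.2
    rw [eLpNorm_eq_lintegral_rpow_enorm_toReal hr0 hpqr.2.2.1] at h1
    rw [eLpNorm_eq_lintegral_rpow_enorm_toReal hr0' hr'] at h2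
    exact ENNReal.mul_lt_top h1 h2
  simp_rw [conv_def, ← integral_mul_const]
  rw [integral_integral_swap hint]
  refine integral_congr_ae (Filter.Eventually.of_forall fun y => ?_)
  simp only [← integral_const_mul, mul_assoc]

/-! ### Exponents -/

theorem Exponent.exists_conj (p : Exponent) : ∃ q : Exponent, (p : ℝ≥0∞).HolderConjugate q := by
  have h := ENNReal.HolderConjugate.conjExponent p.2.1.le
  have h' := h.symm
  exact ⟨⟨p.1.conjExponent, (ENNReal.HolderConjugate.lt_top_iff_one_lt p p.1.conjExponent).1 p.2.2,
    (ENNReal.HolderConjugate.lt_top_iff_one_lt p.1.conjExponent p).2 p.2.1⟩, h⟩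

/-- Solve 1/q = 1 + 1/r - 1/p. The strict inequality p < r is what makes q > 1, the range in which K
is known to be in `L_q`; p > 1 makes q finite. -/
theorem Exponent.exists_young {p r : Exponent} (h : p < r) :
    ∃ q : Exponent, YoungTriple p q r := by
  have hlt : (r : ℝ≥0∞)⁻¹ < (p : ℝ≥0∞)⁻¹ := ENNReal.inv_lt_inv.2 h
  have hp1 : (p : ℝ≥0∞)⁻¹ < 1 := ENNReal.inv_lt_one.2 p.2.1
  have hle : (p : ℝ≥0∞)⁻¹ ≤ 1 + (r : ℝ≥0∞)⁻¹ := hp1.le.trans le_self_add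
  set x : ℝ≥0∞ := 1 + (r : ℝ≥0∞)⁻¹ - (p : ℝ≥0∞)⁻¹ with hx
  have hsum : (p : ℝ≥0∞)⁻¹ + x = 1 + (r : ℝ≥0∞)⁻¹ := add_tsub_cancel_of_le hle
  have hx0 : x ≠ 0 := by
    intro h0
    rw [h0, add_zero] at hsum
    exact absurd (hsum ▸ hp1) (not_lt.2 le_self_add)
  have hx1 : x < 1 := by
    by_contra hge
    have h1 : (p : ℝ≥0∞)⁻¹ + 1 ≤ 1 + (r : ℝ≥0∞)⁻¹ := hsum ▸ (by gcongr; exact not_lt.1 hge)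
    rw [add_comm] at h1
    exact absurd ((ENNReal.add_le_add_iff_left ENNReal.one_ne_top).1 h1) (not_le.2 hlt)
  refine ⟨⟨x⁻¹, ENNReal.one_lt_inv.2 hx1, lt_top_iff_ne_top.2 (ENNReal.inv_ne_top.2 hx0)⟩,
    p.2.1.le, (ENNReal.one_lt_inv.2 hx1).le, r.2.2.ne, ?_⟩
  rw [inv_inv]
  exact hsum

theorem youngTriple_one_right (p : Exponent) : YoungTriple p 1 p :=
  ⟨p.2.1.le, le_rfl, p.2.2.ne, by rw [inv_one, add_comm]⟩

/-- The open end at 1 leaves room below any finite set of exponents, hence below all the norms that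
control one continuous functional. -/
theorem Exponent.exists_lt (t : Finset Exponent) : ∃ s : Exponent, ∀ p ∈ t, s < p := by
  induction t using Finset.induction_on with
  | empty => exact ⟨Classical.arbitrary _, by simp⟩
  | insert a t _ ih =>
    obtain ⟨s, hs⟩ := ih
    have hm : (1 : ℝ≥0∞) < min (s : ℝ≥0∞) a := lt_min s.2.1 a.2.1
    obtain ⟨c, h1, h2⟩ := exists_between hm
    refine ⟨⟨c, h1, (h2.trans_le (min_le_left _ _)).trans s.2.2⟩, fun p hp => ?_⟩
    rcases Finset.mem_insert.1 hp with rfl | hp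
    · exact h2.trans_le (min_le_right _ _)
    · exact lt_trans (h2.trans_le (min_le_left _ _)) (hs p hp)

/-! ### Duality -/

/-- A function that defines a bounded functional for the norm of `L_s` on the bounded functions
of bounded support belongs to the conjugate space. -/
theorem memLp_of_forall_integral_le {f : ℝ → ℂ} (hf : StronglyMeasurable f) {s r : Exponent}
    [(s : ℝ≥0∞).HolderConjugate r] (C : ℝ)
    (h : ∀ g : ℝ → ℂ, Measurable g → (∃ M : ℝ, ∀ x, ‖g x‖ ≤ M) →
      (∃ n : ℝ, ∀ x, n < |x| → g x = 0) →
      ‖∫ x, f x * conj (g x)‖ ≤ C * (eLpNorm g s volume).toReal) :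
    MemLp f r volume := by
  have hs0 : (s : ℝ≥0∞) ≠ 0 := (zero_lt_one.trans s.2.1).ne'
  have hr0 : (r : ℝ≥0∞) ≠ 0 := (zero_lt_one.trans r.2.1).ne'
  have hsr : (s : ℝ≥0∞).toReal.HolderConjugate (r : ℝ≥0∞).toReal :=
    ENNReal.HolderConjugate.toReal_of_ne_top s.2.2.ne r.2.2.ne
  set a := (s : ℝ≥0∞).toReal with ha
  set b := (r : ℝ≥0∞).toReal with hb
  have ha1 : 1 < a := hsr.lt
  have hb1 : 1 < b := hsr.symm.lt
  have hba : (b - 1) * a = b := hsr.symm.sub_one_mul_conj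
  -- Truncating both the support and the size of f makes the test functions admissible and the
  -- integrals J finite.
  let A : ℕ → Set ℝ := fun n => {x | |x| ≤ n ∧ ‖f x‖ ≤ n}
  have hA : ∀ n, MeasurableSet (A n) := fun n =>
    (measurableSet_le continuous_abs.measurable measurable_const).inter
      (measurableSet_le hf.norm.measurable measurable_const)
  -- The extremal function of Hölder's inequality: on `A n`, |g|^a = |f|^b and f · conj g = |f|^b.
  let g : ℕ → ℝ → ℂ := fun n => (A n).indicator fun x => f x * ((‖f x‖ ^ (b - 2) : ℝ) : ℂ)
  have hnorm : ∀ x, ‖f x * ((‖f x‖ ^ (b - 2) : ℝ) : ℂ)‖ = ‖f x‖ ^ (b - 1) := by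
    intro x
    rcases eq_or_ne (f x) 0 with h0 | h0
    · rw [h0, zero_mul, norm_zero, Real.zero_rpow (by linarith)]
    · have : 0 < ‖f x‖ := norm_pos_iff.2 h0
      rw [norm_mul, Complex.norm_real, Real.norm_of_nonneg (by positivity)]
      nth_rewrite 1 [← Real.rpow_one ‖f x‖]
      rw [← Real.rpow_add this]
      congr 1
      ring
  have hprod : ∀ x, f x * conj (f x * ((‖f x‖ ^ (b - 2) : ℝ) : ℂ)) = ((‖f x‖ ^ b : ℝ) : ℂ) := by
    intro x
    rcases eq_or_ne (f x) 0 with h0 | h0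
    · rw [h0, zero_mul, norm_zero, Real.zero_rpow (by linarith), Complex.ofReal_zero]
    · have : 0 < ‖f x‖ := norm_pos_iff.2 h0
      rw [map_mul, Complex.conj_ofReal, ← mul_assoc, Complex.mul_conj, Complex.normSq_eq_norm_sq,
        ← Complex.ofReal_mul, ← Real.rpow_natCast, ← Real.rpow_add this]
      congr 2
      push_cast
      ring
  have hbound : ∀ n, ∫⁻ x in A n, ‖f x‖ₑ ^ b ≤ ENNReal.ofReal C ^ b := by
    intro n
    set J := ∫⁻ x in A n, ‖f x‖ₑ ^ b with hJ
    have hJt : J < ⊤ := by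
      refine setLIntegral_lt_top_of_le_nnreal ?_ ⟨(n : NNReal) ^ b, fun x hx => ?_⟩
      · refine ((measure_mono fun x hx => ?_).trans_lt
          (measure_Icc_lt_top (a := -(n : ℝ)) (b := n))).ne
        exact abs_le.1 hx.1
      · rw [ENNReal.coe_rpow_of_nonneg _ (by linarith)]
        refine ENNReal.rpow_le_rpow ?_ (by linarith)
        rw [enorm_le_coe]
        exact hx.2
    have hgs : eLpNorm (g n) s volume = J ^ (1 / a) := by
      rw [eLpNorm_eq_lintegral_rpow_enorm_toReal hs0 s.2.2.ne, hJ, ← lintegral_indicator (hA n)]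
      congr 2 with x
      by_cases hx : x ∈ A n
      · simp only [g, Set.indicator_of_mem hx]
        rw [← ofReal_norm, hnorm, ENNReal.ofReal_rpow_of_nonneg (by positivity) (by linarith),
          ← Real.rpow_mul (norm_nonneg _), hba, ← ENNReal.ofReal_rpow_of_nonneg (norm_nonneg _)
          (by linarith), ofReal_norm]
      · simp only [g, Set.indicator_of_notMem hx, enorm_zero]
        exact ENNReal.zero_rpow_of_pos (by linarith)
    have hint : ∫ x, f x * conj (g n x) = ((J.toReal : ℝ) : ℂ) := by
      have e : (fun x => f x * conj (g n x)) = (A n).indicator fun x => ((‖f x‖ ^ b : ℝ) : ℂ) := by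
        funext x
        by_cases hx : x ∈ A n
        · simp only [g, Set.indicator_of_mem hx, hprod]
        · simp only [g, Set.indicator_of_notMem hx, map_zero, mul_zero]
      rw [e, integral_indicator (hA n), integral_complex_ofReal, integral_eq_lintegral_of_nonneg_ae
        (Filter.Eventually.of_forall fun x => by positivity)
        (hf.norm.measurable.pow_const b).aestronglyMeasurable]
      congr 3
      funext x
      rw [← ENNReal.ofReal_rpow_of_nonneg (norm_nonneg _) (by linarith), ofReal_norm]
    have hm : Measurable (g n) :=
      (hf.measurable.mul (Complex.measurable_ofReal.comp
        (hf.norm.measurable.pow_const (b - 2)))).indicator (hA n)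
    have hmain := h (g n) hm ⟨(n : ℝ) ^ (b - 1), fun x => ?_⟩ ⟨n, fun x hx => ?_⟩
    · rw [hint, hgs, Complex.norm_real, Real.norm_of_nonneg ENNReal.toReal_nonneg] at hmain
      -- As J is finite, a nonzero J allows division by J^(1/a), which leaves J^(1/b) ≤ C uniformly
      -- in n.
      have h2 : J ≤ ENNReal.ofReal C * J ^ (1 / a) := by
        have hfin : J ^ (1 / a) ≠ ⊤ := ENNReal.rpow_ne_top_of_nonneg (by positivity) hJt.ne
        calc J = ENNReal.ofReal J.toReal := (ENNReal.ofReal_toReal hJt.ne).symm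
          _ ≤ ENNReal.ofReal (C * (J ^ (1 / a)).toReal) := ENNReal.ofReal_le_ofReal hmain
          _ = _ := by
            rw [ENNReal.ofReal_mul' ENNReal.toReal_nonneg, ENNReal.ofReal_toReal hfin]
      rcases eq_or_ne J 0 with hJ0 | hJ0
      · rw [hJ0]; exact zero_le
      have h3 : J ^ (1 / b) ≤ ENNReal.ofReal C := by
        have e : J = J ^ (1 / b) * J ^ (1 / a) := by
          rw [← ENNReal.rpow_add _ _ hJ0 hJt.ne, one_div, one_div, add_comm,
            hsr.inv_add_inv_eq_one, ENNReal.rpow_one]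
        have hfin : J ^ (1 / a) ≠ ⊤ := ENNReal.rpow_ne_top_of_nonneg (by positivity) hJt.ne
        have hne : J ^ (1 / a) ≠ 0 := by
          rw [Ne, ENNReal.rpow_eq_zero_iff_of_pos (by positivity)]
          exact hJ0
        exact (ENNReal.mul_le_mul_iff_left hne hfin).1 (e ▸ h2)
      calc J = (J ^ (1 / b)) ^ b := by
            rw [← ENNReal.rpow_mul, one_div, inv_mul_cancel₀ (by linarith), ENNReal.rpow_one]
        _ ≤ _ := ENNReal.rpow_le_rpow h3 (by linarith)
    · by_cases hx : x ∈ A n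
      · simp only [g, Set.indicator_of_mem hx, hnorm]
        exact Real.rpow_le_rpow (norm_nonneg _) hx.2 (by linarith)
      · simp only [g, Set.indicator_of_notMem hx, norm_zero]
        positivity
    · have : x ∉ A n := fun hx' => absurd hx'.1 (not_le.2 hx)
      simp only [g, Set.indicator_of_notMem this]
  refine ⟨hf.aestronglyMeasurable, ?_⟩
  rw [eLpNorm_lt_top_iff_lintegral_rpow_enorm_lt_top hr0 r.2.2.ne]
  have hmono : Monotone A := fun m n hmn x hx =>
    ⟨hx.1.trans (by exact_mod_cast hmn), hx.2.trans (by exact_mod_cast hmn)⟩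
  have hun : ⋃ n, A n = Set.univ := by
    refine Set.eq_univ_of_forall fun x => Set.mem_iUnion.2 ?_
    obtain ⟨n, hn⟩ := exists_nat_ge (max |x| ‖f x‖)
    exact ⟨n, (le_max_left _ _).trans hn, (le_max_right _ _).trans hn⟩
  -- Monotone convergence along the sets `A n` removes the truncation.
  rw [← setLIntegral_univ, ← hun, setLIntegral_iUnion_of_directed _ hmono.directed_le]
  exact (iSup_le hbound).trans_lt (ENNReal.rpow_lt_top_of_nonneg (by linarith) ENNReal.ofReal_ne_top)

noncomputable section

/-! ### The Fourier transform on `L_2` and the kernel -/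

/-- Locally integrable functions that agree as tempered distributions agree almost everywhere. -/
theorem ae_eq_of_forall_schwartz {f g : ℝ → ℂ} (hf : LocallyIntegrable f volume)
    (hg : LocallyIntegrable g volume) (h : ∀ φ : 𝓢(ℝ, ℂ), ∫ x, φ x * f x = ∫ x, φ x * g x) :
    f =ᵐ[volume] g := by
  refine ae_eq_of_integral_contDiff_smul_eq hf hg fun θ hθ hθc => ?_
  have h1 : HasCompactSupport fun x => (θ x : ℂ) := hθc.comp_left Complex.ofReal_zero
  have h2 := h (h1.toSchwartzMap (Complex.ofRealCLM.contDiff.comp hθ))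
  exact h2

/-- Fubini for the symmetric kernel exp(2πi xξ). The form `-innerₗ ℝ` appears because
`VectorFourier` carries a minus sign in its exponent. -/
theorem integral_fourierInv_mul_eq_of_integrable {f g : ℝ → ℂ} (hf : Integrable f volume)
    (hg : Integrable g volume) : ∫ x, 𝓕⁻ f x * g x = ∫ x, f x * 𝓕⁻ g x := by
  have := VectorFourier.integral_fourierIntegral_smul_eq_flip (L := -innerₗ ℝ)
    (μ := volume) (ν := volume) Real.continuous_fourierChar
    (by simpa using by fun_prop) hf hg
  have e : ∀ φ : ℝ → ℂ, VectorFourier.fourierIntegral Real.fourierChar volume (-innerₗ ℝ) φ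
      = 𝓕⁻ φ := by
    intro φ
    funext w
    simp [VectorFourier.fourierIntegral, Real.fourierInv_eq]
  have e' : ∀ φ : ℝ → ℂ, VectorFourier.fourierIntegral Real.fourierChar volume (-innerₗ ℝ).flip φ
      = 𝓕⁻ φ := by
    intro φ
    funext w
    simp [VectorFourier.fourierIntegral, Real.fourierInv_eq, mul_comm]
  rw [e, e'] at this
  simpa using this

theorem continuous_fourierInv {k : ℝ → ℂ} (hk : Integrable k volume) :
    Continuous (𝓕⁻ k) := by
  have := VectorFourier.fourierIntegral_continuous (L := innerₗ ℝ) (μ := volume)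
    Real.continuous_fourierChar (by simpa using by fun_prop) hk
  have h2 : 𝓕⁻ k = (VectorFourier.fourierIntegral Real.fourierChar volume (innerₗ ℝ) k) ∘
      fun x => -x := by
    funext w
    simp [VectorFourier.fourierIntegral, Real.fourierInv_eq]
  rw [h2]
  exact this.comp continuous_neg

/-- On `L_1 ∩ L_2` the inverse Fourier transform is given by the integral. -/
theorem fourierInv_toLp_ae_eq {k : ℝ → ℂ} (hk : Integrable k volume) (hk2 : MemLp k 2 volume) :
    (𝓕⁻ (hk2.toLp k) : Lp ℂ 2 (volume : Measure ℝ)) =ᵐ[volume] 𝓕⁻ k := by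
  refine ae_eq_of_forall_schwartz ((Lp.memLp _).locallyIntegrable one_le_two)
    (continuous_fourierInv hk).locallyIntegrable fun φ => ?_
  have h := congrArg (fun T => T φ) (Lp.fourierInv_toTemperedDistribution_eq (hk2.toLp k))
  simp only [TemperedDistribution.fourierInv_apply, Lp.toTemperedDistribution_apply,
    smul_eq_mul] at h
  rw [← h, ← integral_fourierInv_mul_eq_of_integrable φ.integrable hk]
  refine integral_congr_ae ?_
  filter_upwards [hk2.coeFn_toLp] with x hx
  rw [hx, fourierInv_coe]

theorem integrable_indicator_Lp {Ω : Set ℝ} (hΩ : MeasurableSet Ω) (hfin : volume Ω ≠ ⊤)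
    (f : Lp ℂ 2 (volume : Measure ℝ)) : Integrable (Ω.indicator f) volume := by
  rw [integrable_indicator_iff hΩ]
  have : IsFiniteMeasure (volume.restrict Ω) := ⟨by simpa using hfin.lt_top⟩
  exact ((Lp.memLp f).restrict Ω).integrable one_le_two

/-- The orthogonal projection of `L_2(ℝ)` onto `B^2_Ω`. -/
def bandProjection {Ω : Set ℝ} (hΩ : MeasurableSet Ω) (f : Lp ℂ 2 (volume : Measure ℝ)) :
    Lp ℂ 2 (volume : Measure ℝ) :=
  𝓕⁻ (((Lp.memLp (𝓕 f : Lp ℂ 2 (volume : Measure ℝ))).indicator hΩ).toLp _)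

theorem bandProjection_eq_self_iff {Ω : Set ℝ} (hΩ : MeasurableSet Ω)
    (f : Lp ℂ 2 (volume : Measure ℝ)) : bandProjection hΩ f = f ↔ f ∈ PWHilbert Ω := by
  set F : Lp ℂ 2 (volume : Measure ℝ) := 𝓕 f with hF
  have h1 : bandProjection hΩ f = f ↔ ((Lp.memLp F).indicator hΩ).toLp _ = F := by
    constructor
    · intro h
      have h' := congrArg (fun g => (𝓕 g : Lp ℂ 2 (volume : Measure ℝ))) h
      simp only [bandProjection, fourier_fourierInv_eq] at h'
      exact h'
    · intro h
      calc bandProjection hΩ f = 𝓕⁻ F := congrArg 𝓕⁻ h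
        _ = f := by rw [hF, fourierInv_fourier_eq]
  rw [h1]
  change _ ↔ ∀ᵐ ξ, ξ ∉ Ω → F ξ = 0
  have h2 := ((Lp.memLp F).indicator hΩ).coeFn_toLp
  constructor
  · intro h
    rw [h] at h2
    filter_upwards [h2] with ξ hξ hn
    rw [hξ, Set.indicator_of_notMem hn]
  · intro h
    apply Lp.ext
    filter_upwards [h2, h] with ξ h3 h4
    rw [h3]
    by_cases hξ : ξ ∈ Ω
    · rw [Set.indicator_of_mem hξ]
    · rw [Set.indicator_of_notMem hξ, h4 hξ]

theorem coeFn_pwVector {Ω : Set ℝ} (hΩ : MeasurableSet Ω) (hfin : volume Ω ≠ ⊤) :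
    (pwVector hΩ hfin).1 =ᵐ[volume] pwKernel Ω :=
  fourierInv_toLp_ae_eq ((integrable_indicator_iff hΩ).2 (integrableOn_const hfin))
    (memLp_indicator_const 2 hΩ (1 : ℂ) (Or.inr hfin))

/-- Plancherel: translation of K becomes modulation of χ_Ω. The identity holds at every x and for
all of `L_2`, not only for band-limited f, so the voice formula also computes the projection. -/
theorem inner_translate_pwVector {Ω : Set ℝ} (hΩ : MeasurableSet Ω) (hfin : volume Ω ≠ ⊤)
    (f : Lp ℂ 2 (volume : Measure ℝ)) (x : ℝ) :
    inner ℂ (translate x (pwVector hΩ hfin).1) f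
      = 𝓕⁻ (Ω.indicator (𝓕 f : Lp ℂ 2 (volume : Measure ℝ))) x := by
  set c : Lp ℂ 2 (volume : Measure ℝ) := indicatorConstLp 2 hΩ hfin (1 : ℂ) with hc
  change inner ℂ (translate x (𝓕⁻ c)) f = _
  rw [← Lp.inner_fourier_eq, L2.inner_def, Real.fourierInv_eq]
  refine integral_congr_ae ?_
  have h := fourier_translate x (𝓕⁻ c)
  rw [fourier_fourierInv_eq] at h
  filter_upwards [h, indicatorConstLp_coeFn (p := 2) (hs := hΩ) (hμs := hfin)
    (c := (1 : ℂ))] with ξ h1 h2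
  rw [h1, hc, h2]
  by_cases hξ : ξ ∈ Ω
  · simp [hξ, Circle.smul_def, mul_comm, AddChar.map_neg_eq_inv]
  · simp [hξ]

theorem inner_translate_pwVector_ae_eq {Ω : Set ℝ} (hΩ : MeasurableSet Ω) (hfin : volume Ω ≠ ⊤)
    (f : Lp ℂ 2 (volume : Measure ℝ)) :
    (fun x => inner ℂ (translate x (pwVector hΩ hfin).1) f) =ᵐ[volume] bandProjection hΩ f := by
  have h := fourierInv_toLp_ae_eq (integrable_indicator_Lp hΩ hfin (𝓕 f))
    ((Lp.memLp (𝓕 f : Lp ℂ 2 (volume : Measure ℝ))).indicator hΩ)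
  filter_upwards [h] with x hx
  rw [inner_translate_pwVector, ← hx]
  rfl

theorem pwKernel_neg (Ω : Set ℝ) (x : ℝ) : pwKernel Ω (-x) = conj (pwKernel Ω x) := by
  rw [pwKernel, Real.fourierInv_eq, Real.fourierInv_eq, ← integral_conj]
  congr 1 with ξ
  by_cases hξ : ξ ∈ Ω
  · simp [hξ, Circle.smul_def, AddChar.map_neg_eq_inv]
  · simp [hξ]

theorem conj_pwKernel_sub (Ω : Set ℝ) (x y : ℝ) :
    conj (pwKernel Ω (y - x)) = pwKernel Ω (x - y) := by
  rw [← pwKernel_neg, neg_sub]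

theorem translate_pwVector_ae_eq {Ω : Set ℝ} (hΩ : MeasurableSet Ω) (hfin : volume Ω ≠ ⊤)
    (x : ℝ) : translate x (pwVector hΩ hfin).1 =ᵐ[volume] fun y => pwKernel Ω (y - x) := by
  have h := (measurePreserving_sub_right (volume : Measure ℝ) x).quasiMeasurePreserving.ae
    (coeFn_pwVector hΩ hfin)
  filter_upwards [translate_coeFn x (pwVector hΩ hfin).1, h] with y h1 h2
  rw [h1, h2]

/-- Hermitian symmetry of K turns the conjugated translate in the inner product into the reflected
kernel of the convolution. -/
theorem conv_eq_inner {Ω : Set ℝ} (hΩ : MeasurableSet Ω) (hfin : volume Ω ≠ ⊤)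
    (f : Lp ℂ 2 (volume : Measure ℝ)) (x : ℝ) :
    conv f (pwKernel Ω) x = inner ℂ (translate x (pwVector hΩ hfin).1) f := by
  rw [conv_def, L2.inner_def]
  refine integral_congr_ae ?_
  filter_upwards [translate_pwVector_ae_eq hΩ hfin x] with y hy
  rw [hy, RCLike.inner_apply, conj_pwKernel_sub]

theorem conv_congr_left {f g : ℝ → ℂ} (h : f =ᵐ[volume] g) (k : ℝ → ℂ) :
    conv f k = conv g k := by
  funext x
  rw [conv_def, conv_def]
  refine integral_congr_ae ?_
  filter_upwards [h] with y hy
  rw [hy]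

/-- An `L_2` function is band-limited if and only if it is reproduced by the kernel. -/
theorem conv_pwKernel_ae_eq_iff {Ω : Set ℝ} (hΩ : MeasurableSet Ω) (hfin : volume Ω ≠ ⊤)
    (f : Lp ℂ 2 (volume : Measure ℝ)) :
    conv f (pwKernel Ω) =ᵐ[volume] f ↔ f ∈ PWHilbert Ω := by
  rw [← bandProjection_eq_self_iff hΩ]
  have h : conv f (pwKernel Ω) =ᵐ[volume] bandProjection hΩ f := by
    filter_upwards [inner_translate_pwVector_ae_eq hΩ hfin f] with x hx
    rw [conv_eq_inner hΩ hfin, hx]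
  exact ⟨fun h' => Lp.ext (h.symm.trans h'), fun h' => h.trans (by rw [h'])⟩

theorem voice_eq_conv {Ω : Set ℝ} (hΩ : MeasurableSet Ω) (hfin : volume Ω ≠ ⊤)
    (v : PWHilbert Ω) :
    voice (translation Ω) (pwVector hΩ hfin) v = conv v.1 (pwKernel Ω) := by
  funext x
  rw [conv_eq_inner hΩ hfin]
  rfl

/-- Both sides are the voice transform of u. The equality is pointwise, as needed under an integral
sign in `conv_conv_pwKernel`. -/
theorem conv_pwKernel_self {Ω : Set ℝ} (hΩ : MeasurableSet Ω) (hfin : volume Ω ≠ ⊤) :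
    conv (pwKernel Ω) (pwKernel Ω) = pwKernel Ω := by
  rw [← conv_congr_left (coeFn_pwVector hΩ hfin), ← voice_eq_conv hΩ hfin, voice_pwVector]

/-! ### Hölder's inequality -/

theorem memLp_conj {g : ℝ → ℂ} {p : ℝ≥0∞} (hg : MemLp g p volume) :
    MemLp (fun x => conj (g x)) p volume :=
  hg.congr_norm (Complex.continuous_conj.comp_aestronglyMeasurable hg.1)
    (Filter.Eventually.of_forall fun x => by simp)

theorem integrable_mul_conj {f g : ℝ → ℂ} {p q : ℝ≥0∞} [p.HolderConjugate q]
    (hf : MemLp f p volume) (hg : MemLp g q volume) :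
    Integrable (fun x => f x * conj (g x)) volume :=
  hf.integrable_mul (memLp_conj hg)

theorem norm_integral_mul_conj_le {f g : ℝ → ℂ} {p q : ℝ≥0∞} [p.HolderConjugate q]
    (hf : MemLp f p volume) (hg : MemLp g q volume) :
    ‖∫ x, f x * conj (g x)‖ ≤ (eLpNorm f p volume).toReal * (eLpNorm g q volume).toReal := by
  have h1 : eLpNorm (f • fun x => conj (g x)) 1 volume ≤ eLpNorm f p volume *
      eLpNorm (fun x => conj (g x)) q volume :=
    eLpNorm_smul_le_mul_eLpNorm (memLp_conj hg).1 hf.1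
  have h2 : eLpNorm (fun x => conj (g x)) q volume = eLpNorm g q volume :=
    eLpNorm_congr_norm_ae (Filter.Eventually.of_forall fun x => by simp)
  rw [h2, eLpNorm_one_eq_lintegral_enorm] at h1
  rw [← ENNReal.toReal_mul, ← toReal_enorm]
  refine ENNReal.toReal_mono (ENNReal.mul_ne_top hf.2.ne hg.2.ne) ?_
  exact (enorm_integral_le_lintegral_enorm _).trans h1

theorem Exponent.exists_gt (p : Exponent) : ∃ r : Exponent, p < r := by
  obtain ⟨c, h1, h2⟩ := exists_between p.2.2
  exact ⟨⟨c, p.2.1.trans h1, h2⟩, h1⟩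

/-! ### Convolution with the kernel -/

theorem pwKernel_convolutionExistsAt {Ω : Set ℝ}
    (hK : ∀ p : Exponent, MemLp (pwKernel Ω) p volume) {f : ℝ → ℂ} {p : Exponent}
    (hf : MemLp f p volume) (x : ℝ) :
    ConvolutionExistsAt f (pwKernel Ω) x (ContinuousLinearMap.mul ℂ ℂ) volume := by
  obtain ⟨q, hq⟩ := p.exists_conj
  exact convolutionExistsAt_of_memLp hf (hK q) x

theorem reproduced_iff {Ω : Set ℝ} (hK : ∀ p : Exponent, MemLp (pwKernel Ω) p volume)
    {f : ℝ →ₘ[volume] ℂ} {p : Exponent} (hf : MemLp f p volume) :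
    Reproduced (pwKernel Ω) f ↔ conv f (pwKernel Ω) =ᵐ[volume] f :=
  ⟨fun h => h.2, fun h =>
    ⟨Filter.Eventually.of_forall (pwKernel_convolutionExistsAt hK hf), h⟩⟩

theorem memLp_conv_pwKernel {Ω : Set ℝ} (hK : ∀ p : Exponent, MemLp (pwKernel Ω) p volume)
    {f : ℝ → ℂ} {p r : Exponent} (hf : MemLp f p volume) (hpr : p < r) :
    MemLp (conv f (pwKernel Ω)) r volume := by
  obtain ⟨q, hq⟩ := Exponent.exists_young hpr
  exact memLp_convolution hq hf (hK q)

/-- Associativity by Fubini and K * K = K. The auxiliary r > p is where f * K lives, and K is in the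
conjugate space of `L_r`. -/
theorem conv_conv_pwKernel {Ω : Set ℝ} (hΩ : MeasurableSet Ω) (hfin : volume Ω ≠ ⊤)
    (hK : ∀ p : Exponent, MemLp (pwKernel Ω) p volume) {f : ℝ → ℂ} {p : Exponent}
    (hf : MemLp f p volume) :
    conv (conv f (pwKernel Ω)) (pwKernel Ω) = conv f (pwKernel Ω) := by
  obtain ⟨r, hpr⟩ := p.exists_gt
  obtain ⟨q, hq⟩ := Exponent.exists_young hpr
  obtain ⟨r', hr'⟩ := r.exists_conj
  funext x
  rw [conv_def, integral_convolution_mul hq r'.2.2.ne hf (hK q) (memLp_sub_left (hK r') x),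
    conv_def]
  congr 1 with y
  congr 1
  rw [← congrFun (conv_pwKernel_self hΩ hfin) (x - y), conv_def,
    ← integral_sub_right_eq_self (fun z => pwKernel Ω z * pwKernel Ω (x - y - z)) y]
  congr 1 with z
  rw [sub_sub_sub_cancel_right]

/-- Convolution with the kernel is a symmetric operator. -/
theorem integral_conv_pwKernel_mul_conj {Ω : Set ℝ}
    (hK : ∀ p : Exponent, MemLp (pwKernel Ω) p volume) {f g : ℝ → ℂ} {p r r' : Exponent}
    [(r : ℝ≥0∞).HolderConjugate r'] (hpr : p < r)
    (hf : MemLp f p volume) (hg : MemLp g r' volume) :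
    ∫ x, conv f (pwKernel Ω) x * conj (g x) = ∫ x, f x * conj (conv g (pwKernel Ω) x) := by
  obtain ⟨q, hq⟩ := Exponent.exists_young hpr
  rw [integral_convolution_mul hq r'.2.2.ne hf (hK q) (memLp_conj hg)]
  congr 1 with y
  rw [conv_def, ← integral_conj]
  congr 2 with x
  rw [map_mul, conj_pwKernel_sub, mul_comm]

/-! ### The test space -/

section Test

variable {Ω : Set ℝ} {hΩ : MeasurableSet Ω} {hfin : volume Ω ≠ ⊤}

theorem PWTest.conv_fn (g : PWTest hΩ hfin) : conv g.fn (pwKernel Ω) =ᵐ[volume] g.fn :=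
  (conv_pwKernel_ae_eq_iff hΩ hfin _).2 (TestSpace.val g).2

theorem PWTest.voice_ae_eq (g : PWTest hΩ hfin) :
    voice (translation Ω) (pwVector hΩ hfin) g.val =ᵐ[volume] g.fn := by
  rw [voice_eq_conv]
  exact g.conv_fn

theorem PWTest.memLp (g : PWTest hΩ hfin) (p : Exponent) : MemLp g.fn p volume :=
  (memLp_congr_ae g.voice_ae_eq).1 (g.2 p)

theorem testSeminorm_eq (p : Exponent) (g : PWTest hΩ hfin) :
    testSeminorm (translation Ω) (pwVector hΩ hfin) p g = (eLpNorm g.fn p volume).toReal :=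
  congrArg ENNReal.toReal (eLpNorm_congr_ae g.voice_ae_eq)

theorem withSeminorms_testSeminorm (hΩ : MeasurableSet Ω) (hfin : volume Ω ≠ ⊤) :
    WithSeminorms (testSeminorm (translation Ω) (pwVector hΩ hfin)) := ⟨rfl⟩

theorem PWTest.ext_fn {g h : PWTest hΩ hfin} (e : g.fn =ᵐ[volume] h.fn) : g = h :=
  Subtype.ext (Subtype.ext (Lp.ext e))

theorem PWTest.fn_add (g h : PWTest hΩ hfin) : (g + h).fn =ᵐ[volume] fun x => g.fn x + h.fn x :=
  Lp.coeFn_add (TestSpace.val g).1 (TestSpace.val h).1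

theorem PWTest.fn_smul (c : ℂ) (g : PWTest hΩ hfin) :
    (c • g).fn =ᵐ[volume] fun x => c * g.fn x :=
  Lp.coeFn_smul c (TestSpace.val g).1

theorem PWTest.exists_of_conv_eq (hΩ : MeasurableSet Ω) (hfin : volume Ω ≠ ⊤) {f : ℝ → ℂ}
    (hf : ∀ p : Exponent, MemLp f p volume) (hrep : conv f (pwKernel Ω) =ᵐ[volume] f) :
    ∃ g : PWTest hΩ hfin, g.fn =ᵐ[volume] f := by
  have h2 : MemLp f 2 volume := hf ⟨2, by norm_num, by norm_num⟩
  have hco := h2.coeFn_toLp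
  have hmem : h2.toLp f ∈ PWHilbert Ω := by
    rw [← conv_pwKernel_ae_eq_iff hΩ hfin, conv_congr_left hco]
    exact hrep.trans hco.symm
  have hv : ∀ p : Exponent, MemLp (voice (translation Ω) (pwVector hΩ hfin)
      ⟨h2.toLp f, hmem⟩) p volume := by
    intro p
    rw [voice_eq_conv, conv_congr_left hco]
    exact (memLp_congr_ae hrep).2 (hf p)
  exact ⟨⟨⟨h2.toLp f, hmem⟩, hv⟩, hco⟩

theorem range_fn (hΩ : MeasurableSet Ω) (hfin : volume Ω ≠ ⊤)
    (hK : ∀ p : Exponent, MemLp (pwKernel Ω) p volume) :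
    Set.range (fun g : PWTest hΩ hfin => g.fn)
      = {f | f ∈ targetSpace ∧ Reproduced (pwKernel Ω) f} := by
  ext f
  constructor
  · rintro ⟨g, rfl⟩
    exact ⟨g.memLp, (reproduced_iff hK (g.memLp (Classical.arbitrary _))).2 g.conv_fn⟩
  · rintro ⟨hf, hr⟩
    obtain ⟨g, hg⟩ := PWTest.exists_of_conv_eq hΩ hfin hf hr.2
    exact ⟨g, AEEqFun.ext hg⟩

/-! ### The functionals defined by functions -/

/-- The antilinear map `g ↦ ∫ f(x) conj(g(x)) dx` on the test space. -/
def functionalLinear (hΩ : MeasurableSet Ω) (hfin : volume Ω ≠ ⊤) (f : ℝ → ℂ)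
    (hf : ∃ p : Exponent, MemLp f p volume) :
    PWTest hΩ hfin →ₗ⋆[ℂ] ℂ where
  toFun g := ∫ x, f x * conj (PWTest.fn g x)
  map_add' g h := by
    obtain ⟨p, hp⟩ := hf
    obtain ⟨q, hq⟩ := p.exists_conj
    rw [← integral_add (integrable_mul_conj hp (PWTest.memLp g q))
      (integrable_mul_conj hp (PWTest.memLp h q))]
    refine integral_congr_ae ?_
    filter_upwards [PWTest.fn_add g h] with x hx
    rw [hx, map_add, mul_add]
  map_smul' c g := by
    rw [smul_eq_mul, ← integral_const_mul]
    refine integral_congr_ae ?_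
    filter_upwards [PWTest.fn_smul c g] with x hx
    rw [hx, map_mul]
    ring

/-- The antilinear functional `g ↦ ∫ f(x) conj(g(x)) dx` on the test space. -/
def functional (hΩ : MeasurableSet Ω) (hfin : volume Ω ≠ ⊤) (f : ℝ → ℂ)
    (hf : ∃ p : Exponent, MemLp f p volume) :
    AntiDual (translation Ω) (pwVector hΩ hfin) where
  toLinearMap := functionalLinear hΩ hfin f hf
  cont := by
    obtain ⟨p, hp⟩ := hf
    obtain ⟨q, hq⟩ := p.exists_conj
    refine (withSeminorms_testSeminorm hΩ hfin).continuous_normedSpace_rng ℂ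
      (functionalLinear hΩ hfin f ⟨p, hp⟩)
      ⟨{q}, ⟨(eLpNorm f p volume).toReal, ENNReal.toReal_nonneg⟩, fun g => ?_⟩
    rw [Finset.sup_singleton]
    refine (norm_integral_mul_conj_le hp (PWTest.memLp g q)).trans (le_of_eq ?_)
    rw [← testSeminorm_eq]
    rfl

theorem functional_apply (f : ℝ → ℂ) (hf : ∃ p : Exponent, MemLp f p volume)
    (g : PWTest hΩ hfin) :
    functional hΩ hfin f hf g = ∫ x, f x * conj (PWTest.fn g x) := rfl

/-- No reproduction of f is assumed: the extended voice transform sees f only through f * K. On M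
this is the inverse of the map from functions to functionals. -/
theorem extVoice_functional (hK : Admissible (translation Ω) (pwVector hΩ hfin)) (f : ℝ → ℂ)
    (hf : ∃ p : Exponent, MemLp f p volume) :
    extVoice hK (functional hΩ hfin f hf) = conv f (pwKernel Ω) := by
  funext x
  rw [extVoice, functional_apply, conv_def]
  refine integral_congr_ae ?_
  have h : PWTest.fn (orbit (translation Ω) (pwVector hΩ hfin) hK x) =ᵐ[volume]
      fun y => pwKernel Ω (y - x) := translate_pwVector_ae_eq hΩ hfin x
  filter_upwards [h] with y hy
  rw [hy, conj_pwKernel_sub]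

end Test

/-! ### The functionals on the test space are given by functions -/

section Representation

variable {Ω : Set ℝ} {hΩ : MeasurableSet Ω} {hfin : volume Ω ≠ ⊤}

/-- The functions that belong to `L_r` for all `1 < r < 2`. -/
def NearOne (g : ℝ → ℂ) : Prop := ∀ r : Exponent, (r : ℝ≥0∞) < 2 → MemLp g r volume

/-- For each target exponent p, some s < min(p, 2) is available for g, and Young moves g * K from
`L_s` up to `L_p`; so integrability near 1 alone suffices. -/
theorem exists_smooth (hΩ : MeasurableSet Ω) (hfin : volume Ω ≠ ⊤)
    (hK : ∀ p : Exponent, MemLp (pwKernel Ω) p volume) {g : ℝ → ℂ} (hg : NearOne g) :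
    ∃ v : PWTest hΩ hfin, v.fn =ᵐ[volume] conv g (pwKernel Ω) := by
  have key : ∀ p : Exponent, ∃ s : Exponent, MemLp g s volume ∧ s < p := by
    intro p
    obtain ⟨s, hs⟩ := Exponent.exists_lt {p, ⟨2, by norm_num, by norm_num⟩}
    exact ⟨s, hg s (hs ⟨2, by norm_num, by norm_num⟩ (by simp)), hs p (by simp)⟩
  refine PWTest.exists_of_conv_eq hΩ hfin (fun p => ?_) ?_
  · obtain ⟨s, h1, h2⟩ := key p
    exact memLp_conv_pwKernel hK h1 h2
  · obtain ⟨s, h1, h2⟩ := key (Classical.arbitrary _)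
    rw [conv_conv_pwKernel hΩ hfin hK h1]

/-- The convolution `g * K` as an element of the test space. -/
def smooth (hΩ : MeasurableSet Ω) (hfin : volume Ω ≠ ⊤)
    (hK : ∀ p : Exponent, MemLp (pwKernel Ω) p volume) (g : ℝ → ℂ) (hg : NearOne g) :
    PWTest hΩ hfin :=
  (exists_smooth hΩ hfin hK hg).choose

theorem fn_smooth (hK : ∀ p : Exponent, MemLp (pwKernel Ω) p volume) (g : ℝ → ℂ)
    (hg : NearOne g) : (smooth hΩ hfin hK g hg).fn =ᵐ[volume] conv g (pwKernel Ω) :=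
  (exists_smooth hΩ hfin hK hg).choose_spec

theorem NearOne.exists_memLp {g : ℝ → ℂ} (hg : NearOne g) :
    ∃ s : Exponent, MemLp g s volume := by
  obtain ⟨s, hs⟩ := Exponent.exists_lt {⟨2, by norm_num, by norm_num⟩}
  exact ⟨s, hg s (hs ⟨2, by norm_num, by norm_num⟩ (by simp))⟩

theorem smooth_add (hK : ∀ p : Exponent, MemLp (pwKernel Ω) p volume) {f g h : ℝ → ℂ}
    (hf : NearOne f) (hg : NearOne g) (hh : NearOne h)
    (e : h =ᵐ[volume] fun x => f x + g x) :
    smooth hΩ hfin hK h hh = smooth hΩ hfin hK f hf + smooth hΩ hfin hK g hg := by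
  refine PWTest.ext_fn ?_
  filter_upwards [fn_smooth hK f hf (hΩ := hΩ) (hfin := hfin), fn_smooth hK g hg (hΩ := hΩ)
    (hfin := hfin), fn_smooth hK h hh (hΩ := hΩ) (hfin := hfin),
    PWTest.fn_add (smooth hΩ hfin hK f hf) (smooth hΩ hfin hK g hg)] with x h1 h2 h3 h4
  rw [h3, h4, h1, h2, conv_congr_left e]
  obtain ⟨p, hp⟩ := hf.exists_memLp
  obtain ⟨q, hq⟩ := hg.exists_memLp
  have i1 : Integrable (fun y => f y * pwKernel Ω (x - y)) volume :=
    pwKernel_convolutionExistsAt hK hp x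
  have i2 : Integrable (fun y => g y * pwKernel Ω (x - y)) volume :=
    pwKernel_convolutionExistsAt hK hq x
  rw [conv_def, conv_def, conv_def, ← integral_add i1 i2]
  congr 1 with y
  exact add_mul _ _ _

theorem smooth_smul (hK : ∀ p : Exponent, MemLp (pwKernel Ω) p volume) {g h : ℝ → ℂ} (c : ℂ)
    (hg : NearOne g) (hh : NearOne h) (e : h =ᵐ[volume] fun x => c * g x) :
    smooth hΩ hfin hK h hh = c • smooth hΩ hfin hK g hg := by
  refine PWTest.ext_fn ?_
  filter_upwards [fn_smooth hK g hg (hΩ := hΩ) (hfin := hfin), fn_smooth hK h hh (hΩ := hΩ)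
    (hfin := hfin), PWTest.fn_smul c (smooth hΩ hfin hK g hg)] with x h2 h3 h4
  rw [h3, h4, h2, conv_congr_left e, conv_def, conv_def, ← integral_const_mul]
  congr 1 with y
  ring

theorem smooth_congr (hK : ∀ p : Exponent, MemLp (pwKernel Ω) p volume) {g h : ℝ → ℂ}
    (hg : NearOne g) (hh : NearOne h) (e : h =ᵐ[volume] g) :
    smooth hΩ hfin hK h hh = smooth hΩ hfin hK g hg := by
  refine PWTest.ext_fn ?_
  refine (fn_smooth hK h hh).trans ?_
  rw [conv_congr_left e]
  exact (fn_smooth hK g hg).symm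

theorem smooth_fn (hK : ∀ p : Exponent, MemLp (pwKernel Ω) p volume) (v : PWTest hΩ hfin)
    (hv : NearOne v.fn) : smooth hΩ hfin hK v.fn hv = v :=
  PWTest.ext_fn ((fn_smooth hK _ hv).trans v.conv_fn)

/-- Smoothing gains integrability: a functional on the test space is controlled by a single norm
on the functions that are smoothed. -/
theorem exists_bound_smooth (hK : ∀ p : Exponent, MemLp (pwKernel Ω) p volume)
    (T : AntiDual (translation Ω) (pwVector hΩ hfin)) :
    ∃ s : Exponent, (s : ℝ≥0∞) < 2 ∧ ∃ C : ℝ, 0 ≤ C ∧ ∀ (g : ℝ → ℂ) (hg : NearOne g),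
      ‖T (smooth hΩ hfin hK g hg)‖ ≤ C * (eLpNorm g s volume).toReal := by
  obtain ⟨t, C, -, hC⟩ := Seminorm.bound_of_continuous (withSeminorms_testSeminorm hΩ hfin)
    ((normSeminorm ℂ ℂ).comp T.toLinearMap) (continuous_norm.comp T.continuous)
  obtain ⟨s, hs⟩ := Exponent.exists_lt (insert ⟨2, by norm_num, by norm_num⟩ t)
  have hs2 : (s : ℝ≥0∞) < 2 := hs ⟨2, by norm_num, by norm_num⟩ (by simp)
  -- M is the norm of K in the space that Young's inequality pairs with s and p; outside `t` the
  -- value 0 is a dummy that makes `choose` applicable.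
  have key : ∀ p : Exponent, ∃ M : ℝ, 0 ≤ M ∧ (p ∈ t → ∀ (g : ℝ → ℂ) (hg : NearOne g),
      testSeminorm (translation Ω) (pwVector hΩ hfin) p (smooth hΩ hfin hK g hg)
        ≤ M * (eLpNorm g s volume).toReal) := by
    intro p
    by_cases hp : p ∈ t
    · obtain ⟨q, hq⟩ := Exponent.exists_young (hs p (Finset.mem_insert_of_mem hp))
      refine ⟨(eLpNorm (pwKernel Ω) q volume).toReal, ENNReal.toReal_nonneg, fun _ g hg => ?_⟩
      have hgs := hg s hs2
      rw [testSeminorm_eq, eLpNorm_congr_ae (fn_smooth hK g hg), ← ENNReal.toReal_mul, mul_comm]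
      exact ENNReal.toReal_mono (ENNReal.mul_ne_top hgs.2.ne (hK q).2.ne)
        (eLpNorm_convolution_le hgs.1 (hK q).1 hq)
    · exact ⟨0, le_rfl, fun h => absurd h hp⟩
  choose M hM0 hM using key
  have hsum : 0 ≤ ∑ p ∈ t, M p := Finset.sum_nonneg fun p _ => hM0 p
  refine ⟨s, hs2, C * ∑ p ∈ t, M p, by positivity, fun g hg => ?_⟩
  refine (hC (smooth hΩ hfin hK g hg)).trans ?_
  rw [mul_assoc]
  refine mul_le_mul_of_nonneg_left ?_ C.2
  refine Seminorm.finset_sup_apply_le (by positivity) fun p hp => (hM p hp g hg).trans ?_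
  exact mul_le_mul_of_nonneg_right (Finset.single_le_sum (fun p _ => hM0 p) hp)
    ENNReal.toReal_nonneg

/-! ### Gaussian weights and the Riesz representation -/

/-- The Gaussian `exp(-x²)`. -/
def gauss (x : ℝ) : ℂ := (Real.exp (-x ^ 2) : ℂ)

theorem continuous_gauss : Continuous gauss := by
  unfold gauss
  fun_prop

theorem norm_gauss (x : ℝ) : ‖gauss x‖ = Real.exp (-x ^ 2) := by
  rw [gauss, Complex.norm_real, Real.norm_of_nonneg (Real.exp_pos _).le]

theorem gauss_ne_zero (x : ℝ) : gauss x ≠ 0 := by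
  rw [← norm_pos_iff, norm_gauss]
  exact Real.exp_pos _

theorem memLp_gauss {p : ℝ≥0∞} (hp : p ≠ 0) (hp' : p ≠ ⊤) : MemLp gauss p volume := by
  rw [← integrable_norm_rpow_iff continuous_gauss.aestronglyMeasurable hp hp']
  refine (integrable_exp_neg_mul_sq (ENNReal.toReal_pos hp hp')).congr ?_
  refine Filter.Eventually.of_forall fun x => ?_
  simp only [norm_gauss, ← Real.exp_mul]
  congr 1
  ring

theorem exists_holderTriple_two {r : Exponent} (hr : (r : ℝ≥0∞) < 2) :
    ∃ t : ℝ≥0∞, t ≠ 0 ∧ t ≠ ⊤ ∧ ENNReal.HolderTriple t 2 r := by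
  have h1 : (2 : ℝ≥0∞)⁻¹ < (r : ℝ≥0∞)⁻¹ := ENNReal.inv_lt_inv.2 hr
  have h0 : (r : ℝ≥0∞)⁻¹ ≠ ⊤ := ENNReal.inv_ne_top.2 (zero_lt_one.trans r.2.1).ne'
  refine ⟨((r : ℝ≥0∞)⁻¹ - 2⁻¹)⁻¹, ENNReal.inv_ne_zero.2 (ENNReal.sub_ne_top h0),
    ENNReal.inv_ne_top.2 (tsub_pos_of_lt h1).ne', ⟨?_⟩⟩
  rw [inv_inv, tsub_add_cancel_of_le h1.le]

theorem eLpNorm_gauss_mul_le {k : ℝ → ℂ} (hk : AEStronglyMeasurable k volume) {t r : ℝ≥0∞}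
    [ENNReal.HolderTriple t 2 r] : eLpNorm (fun x => gauss x * k x) r volume ≤
      eLpNorm gauss t volume * eLpNorm k 2 volume := by
  have h := eLpNorm_smul_le_mul_eLpNorm (p := t) (q := 2) (r := r) hk
    continuous_gauss.aestronglyMeasurable
  exact h

/-- The weight pushes all of `L_2` into the domain of smoothing, so that the Riesz theorem on a
Hilbert space becomes available. -/
theorem nearOne_gauss_mul {k : ℝ → ℂ} (hk : MemLp k 2 volume) :
    NearOne (fun x => gauss x * k x) := by
  intro r hr
  obtain ⟨t, h0, h1, h2⟩ := exists_holderTriple_two hr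
  exact hk.mul (memLp_gauss h0 h1)

theorem nearOne_of_forall_memLp {g : ℝ → ℂ} (hg : ∀ p : Exponent, MemLp g p volume) :
    NearOne g := fun r _ => hg r

/-- A functional on the test space, composed with smoothing, is integration against a function,
on functions of bounded support. -/
theorem exists_representation_smooth (hK : ∀ p : Exponent, MemLp (pwKernel Ω) p volume)
    (T : AntiDual (translation Ω) (pwVector hΩ hfin)) :
    ∃ f : ℝ → ℂ, StronglyMeasurable f ∧ ∀ (g : ℝ → ℂ) (hg : NearOne g), MemLp g 2 volume →
      (∃ n : ℝ, ∀ x, n < |x| → g x = 0) →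
      T (smooth hΩ hfin hK g hg) = ∫ x, f x * conj (g x) := by
  obtain ⟨s, hs2, C, hC0, hC⟩ := exists_bound_smooth hK T
  obtain ⟨t, ht0, ht1, ht⟩ := exists_holderTriple_two hs2
  -- T is antilinear, so conjugation makes k ↦ conj T((gauss · k) * K) linear.
  let L : Lp ℂ 2 (volume : Measure ℝ) →ₗ[ℂ] ℂ :=
    { toFun := fun k => conj (T (smooth hΩ hfin hK _ (nearOne_gauss_mul (Lp.memLp k))))
      map_add' := by
        intro k l
        rw [smooth_add hK (nearOne_gauss_mul (Lp.memLp k)) (nearOne_gauss_mul (Lp.memLp l)),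
          map_add, map_add]
        filter_upwards [Lp.coeFn_add k l] with x hx
        rw [hx, Pi.add_apply, mul_add]
      map_smul' := by
        intro c k
        rw [smooth_smul hK c (nearOne_gauss_mul (Lp.memLp k)), map_smulₛₗ]
        · simp
        · filter_upwards [Lp.coeFn_smul c k] with x hx
          rw [hx, Pi.smul_apply, smul_eq_mul]
          ring }
  have hL : ∀ k, ‖L k‖ ≤ C * (eLpNorm gauss t volume).toReal * ‖k‖ := by
    intro k
    change ‖conj (T (smooth hΩ hfin hK _ (nearOne_gauss_mul (Lp.memLp k))))‖ ≤ _
    rw [RCLike.norm_conj, mul_assoc]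
    refine (hC _ _).trans (mul_le_mul_of_nonneg_left ?_ hC0)
    rw [Lp.norm_def, ← ENNReal.toReal_mul]
    refine ENNReal.toReal_mono
      (ENNReal.mul_ne_top (memLp_gauss ht0 ht1).2.ne (Lp.memLp k).2.ne) ?_
    exact eLpNorm_gauss_mul_le (Lp.memLp k).1
  obtain ⟨F, hF⟩ : ∃ F : Lp ℂ 2 (volume : Measure ℝ), ∀ k, inner ℂ F k = L k :=
    ⟨(InnerProductSpace.toDual ℂ _).symm (L.mkContinuous _ hL),
      fun k => InnerProductSpace.toDual_symm_apply⟩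
  -- Undo the weight. F/gauss may grow fast, so at this stage it is paired only with g of bounded
  -- support, for which g/gauss is still in `L_2`.
  refine ⟨fun x => F x * (gauss x)⁻¹, (Lp.stronglyMeasurable F).mul
    (continuous_gauss.inv₀ gauss_ne_zero).stronglyMeasurable, ?_⟩
  rintro g hg hg2 ⟨n, hn⟩
  have hk : MemLp (fun x => (gauss x)⁻¹ * g x) 2 volume := by
    refine MemLp.of_le_mul hg2 (c := Real.exp (n ^ 2))
      ((continuous_gauss.inv₀ gauss_ne_zero).aestronglyMeasurable.mul hg2.1)
      (Filter.Eventually.of_forall fun x => ?_)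
    rcases lt_or_ge n |x| with hx | hx
    · simp [hn x hx]
    · rw [norm_mul, norm_inv, norm_gauss, ← Real.exp_neg, neg_neg]
      refine mul_le_mul_of_nonneg_right (Real.exp_le_exp.2 ?_) (norm_nonneg _)
      rw [← sq_abs]
      exact pow_le_pow_left₀ (abs_nonneg x) hx 2
  have h1 : inner ℂ F (hk.toLp _) = L (hk.toLp _) := hF _
  have h2 : smooth hΩ hfin hK _ (nearOne_gauss_mul (Lp.memLp (hk.toLp _)))
      = smooth hΩ hfin hK g hg := by
    refine smooth_congr hK _ _ ?_
    filter_upwards [hk.coeFn_toLp] with x hx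
    rw [hx, mul_inv_cancel_left₀ (gauss_ne_zero x)]
  have h3 : L (hk.toLp _) = conj (T (smooth hΩ hfin hK g hg)) := by
    rw [← h2]
    rfl
  rw [← Complex.conj_conj (T _), ← h3, ← h1, L2.inner_def, ← integral_conj]
  refine integral_congr_ae ?_
  filter_upwards [hk.coeFn_toLp] with x hx
  rw [hx, RCLike.inner_apply]
  have hc : conj (gauss x) = gauss x := Complex.conj_ofReal _
  simp only [map_mul, map_inv₀, hc, Complex.conj_conj]
  ring

theorem memLp_of_bounded_of_support {g : ℝ → ℂ} (hg : AEStronglyMeasurable g volume)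
    (hb : ∃ M : ℝ, ∀ x, ‖g x‖ ≤ M) (hs : ∃ n : ℝ, ∀ x, n < |x| → g x = 0) (p : ℝ≥0∞) :
    MemLp g p volume := by
  obtain ⟨M, hM⟩ := hb
  obtain ⟨n, hn⟩ := hs
  have e : (Set.Icc (-n) n).indicator g = g := by
    rw [Set.indicator_eq_self]
    intro x hx
    by_contra h
    exact hx (hn x (not_le.1 fun h' => h (abs_le.1 h')))
  rw [← e, memLp_indicator_iff_restrict measurableSet_Icc]
  exact MemLp.of_bound hg.restrict M (Filter.Eventually.of_forall hM)

/-- Every functional on the test space is integration against an `L_r` function for some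
`1 < r < ∞`. -/
theorem exists_representation (hK : ∀ p : Exponent, MemLp (pwKernel Ω) p volume)
    (T : AntiDual (translation Ω) (pwVector hΩ hfin)) :
    ∃ (f : ℝ → ℂ) (r : Exponent), MemLp f r volume ∧
      ∀ v : PWTest hΩ hfin, T v = ∫ x, f x * conj (v.fn x) := by
  obtain ⟨s, hs2, C, hC0, hC⟩ := exists_bound_smooth hK T
  obtain ⟨f, hf, hT⟩ := exists_representation_smooth hK T
  obtain ⟨r, hr⟩ := s.exists_conj
  have hfr : MemLp f r volume := by
    refine memLp_of_forall_integral_le (s := s) hf C fun g hg hb hn => ?_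
    have hgp := memLp_of_bounded_of_support hg.aestronglyMeasurable hb hn
    rw [← hT g (nearOne_of_forall_memLp fun p => hgp p) (hgp 2) hn]
    exact hC g _
  refine ⟨f, r, hfr, fun v => ?_⟩
  set A := (eLpNorm f r volume).toReal
  have hr' := hr.symm
  -- Approximate v in `L_s` by a continuous g of compact support. Here g need not be band-limited,
  -- but T still applies to v = (v - g) * K + g * K; the error is at most C ε for T and A ε for the
  -- integral.
  have happrox : ∀ ε : ℝ, 0 < ε → ‖T v - ∫ x, f x * conj (v.fn x)‖ ≤ (C + A) * ε := by
    intro ε hε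
    obtain ⟨g, hgc, hge, hgcont, -⟩ := (v.memLp s).exists_hasCompactSupport_eLpNorm_sub_le s.2.2.ne
      (ε := ENNReal.ofReal ε) (by simpa using hε)
    have hb : ∃ M : ℝ, ∀ x, ‖g x‖ ≤ M := hgc.exists_bound_of_continuous hgcont
    have hn : ∃ n : ℝ, ∀ x, n < |x| → g x = 0 := by
      obtain ⟨n, hn⟩ := hgc.isCompact.isBounded.subset_closedBall (0 : ℝ)
      refine ⟨n, fun x hx => ?_⟩
      by_contra h
      have := hn (subset_tsupport g h)
      rw [Metric.mem_closedBall, dist_zero_right, Real.norm_eq_abs] at this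
      linarith
    have hgp := memLp_of_bounded_of_support hgcont.aestronglyMeasurable hb hn
    have hgN : NearOne g := nearOne_of_forall_memLp fun p => hgp p
    have hd : ∀ p : Exponent, MemLp (⇑v.fn - g) p volume := fun p => (v.memLp p).sub (hgp p)
    have hdN : NearOne (⇑v.fn - g) := nearOne_of_forall_memLp hd
    have hvN : NearOne v.fn := nearOne_of_forall_memLp v.memLp
    have e1 : v = smooth hΩ hfin hK _ hdN + smooth hΩ hfin hK g hgN := by
      rw [← smooth_add hK hdN hgN hvN (Filter.Eventually.of_forall fun x => by simp),
        smooth_fn]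
    have e2 : T v = T (smooth hΩ hfin hK _ hdN) + ∫ x, f x * conj (g x) := by
      conv_lhs => rw [e1]
      rw [map_add, hT g hgN (hgp 2) hn]
    have e3 : ∫ x, f x * conj (v.fn x)
        = (∫ x, f x * conj ((⇑v.fn - g) x)) + ∫ x, f x * conj (g x) := by
      rw [← integral_add (integrable_mul_conj hfr (hd s)) (integrable_mul_conj hfr (hgp s))]
      congr 1 with x
      simp only [Pi.sub_apply, map_sub]
      ring
    have hle : (eLpNorm (⇑v.fn - g) s volume).toReal ≤ ε :=
      ENNReal.toReal_le_of_le_ofReal hε.le hge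
    rw [e2, e3, add_sub_add_right_eq_sub, add_mul]
    refine (norm_sub_le _ _).trans (add_le_add ?_ ?_)
    · exact (hC _ hdN).trans (mul_le_mul_of_nonneg_left hle hC0)
    · exact (norm_integral_mul_conj_le hfr (hd s)).trans
        (mul_le_mul_of_nonneg_left hle ENNReal.toReal_nonneg)
  have hCA : 0 ≤ C + A := add_nonneg hC0 ENNReal.toReal_nonneg
  rw [← sub_eq_zero, ← norm_le_zero_iff]
  refine le_of_forall_pos_le_add fun δ hδ => ?_
  refine (happrox (δ / (C + A + 1)) (by positivity)).trans ?_
  rw [zero_add, ← mul_div_assoc, div_le_iff₀ (by positivity)]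
  nlinarith

/-- Projecting the representing function to f * K leaves the functional unchanged, because K moves
across the pairing and v * K = v. The price is a larger exponent r, which is harmless in the union
M. -/
theorem exists_eq_functional (hK : ∀ p : Exponent, MemLp (pwKernel Ω) p volume)
    (T : AntiDual (translation Ω) (pwVector hΩ hfin)) :
    ∃ (f : ℝ → ℂ) (hf : ∃ p : Exponent, MemLp f p volume),
      conv f (pwKernel Ω) =ᵐ[volume] f ∧ functional hΩ hfin f hf = T := by
  obtain ⟨f, p, hf, hT⟩ := exists_representation hK T
  obtain ⟨r, hpr⟩ := p.exists_gt
  obtain ⟨r', hr'⟩ := r.exists_conj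
  refine ⟨conv f (pwKernel Ω), ⟨r, memLp_conv_pwKernel hK hf hpr⟩, ?_, ?_⟩
  · rw [conv_conv_pwKernel hΩ hfin hK hf]
  · ext v
    rw [functional_apply, integral_conv_pwKernel_mul_conj hK hpr hf (PWTest.memLp v r'), hT v]
    refine integral_congr_ae ?_
    filter_upwards [PWTest.conv_fn v] with x hx
    rw [hx]

end Representation

end

/-! ### Paley-Wiener spaces -/

theorem isFourierTransform_Lp (f : Lp ℂ 2 (volume : Measure ℝ)) :
    IsFourierTransform f (𝓕 f : Lp ℂ 2 (volume : Measure ℝ)) := by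
  refine ⟨(Lp.memLp _).locallyIntegrable one_le_two, fun φ => ⟨?_, ?_⟩⟩
  · exact (φ.memLp 2 volume).integrable_mul (Lp.memLp _)
  · have h := congrArg (fun T => T φ) (Lp.fourier_toTemperedDistribution_eq f)
    simpa only [TemperedDistribution.fourier_apply, Lp.toTemperedDistribution_apply,
      smul_eq_mul, fourier_coe] using h

theorem IsFourierTransform.congr_left {f f' g : ℝ → ℂ} (h : IsFourierTransform f g)
    (e : f' =ᵐ[volume] f) : IsFourierTransform f' g := by
  refine ⟨h.1, fun φ => ⟨(h.2 φ).1, ?_⟩⟩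
  rw [← (h.2 φ).2]
  refine integral_congr_ae ?_
  filter_upwards [e] with x hx
  rw [hx]

/-- At p = 2 the choice is q = 1, which is not an `Exponent`; this suits Schwartz functions, which
lie in every `L_q`. -/
theorem exists_youngTriple_two {p : Exponent} (hp : (p : ℝ≥0∞) ≤ 2) :
    ∃ q : ℝ≥0∞, YoungTriple p q 2 := by
  rcases hp.eq_or_lt with h | h
  · exact ⟨1, by simpa only [h] using youngTriple_one_right p⟩
  · obtain ⟨q, hq⟩ := Exponent.exists_young (p := p) (r := ⟨2, by norm_num, by norm_num⟩) h
    exact ⟨q, hq⟩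

/-- The Fourier transform of a product of Schwartz functions. -/
theorem integral_sub_mul_fourier (φ ψ : 𝓢(ℝ, ℂ)) (y : ℝ) :
    ∫ x, ψ (x - y) * 𝓕 φ x = 𝓕 (pairing (ContinuousLinearMap.mul ℂ ℂ) φ (𝓕 ψ)) y := by
  have h1 : 𝓕⁻ (pairing (ContinuousLinearMap.mul ℂ ℂ) φ (𝓕 ψ))
      = SchwartzMap.convolution (ContinuousLinearMap.mul ℂ ℂ) (𝓕⁻ φ) ψ := by
    have e : SchwartzMap.convolution (ContinuousLinearMap.mul ℂ ℂ) (𝓕⁻ φ) ψ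
      = 𝓕⁻ (pairing (ContinuousLinearMap.mul ℂ ℂ) (𝓕 (𝓕⁻ φ : 𝓢(ℝ, ℂ))) (𝓕 ψ)) := rfl
    rw [e, fourier_fourierInv_eq]
  -- Evaluation at -y turns the inverse transforms into forward ones.
  have h2 := congrArg (fun F : 𝓢(ℝ, ℂ) => F (-y)) h1
  simp only [convolution_apply, convolution_def, ContinuousLinearMap.mul_apply'] at h2
  have h3 : ∀ (F : 𝓢(ℝ, ℂ)) (x : ℝ), (𝓕⁻ F : 𝓢(ℝ, ℂ)) (-x) = (𝓕 F : 𝓢(ℝ, ℂ)) x := by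
    intro F x
    rw [fourierInv_coe, fourier_coe, Real.fourierInv_eq_fourier_neg, neg_neg]
  rw [h3] at h2
  rw [h2, ← integral_neg_eq_self]
  congr 1 with x
  rw [← h3, neg_neg, mul_comm, show -x - y = -y - x by ring]

/-- Fubini on each side leaves f integrated against k * l and l * k respectively, matched by z ↦ x +
y - z. The two Young triples serve the two orders of convolution. -/
theorem conv_conv_comm {f k l : ℝ → ℂ} {p q q' r r' s s' : ℝ≥0∞} (h : YoungTriple p q r)
    (h' : YoungTriple p q' s) [r.HolderConjugate r'] [s.HolderConjugate s'] (hr' : r' ≠ ⊤)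
    (hs' : s' ≠ ⊤) (hf : MemLp f p volume) (hk : MemLp k q volume) (hk' : MemLp k s' volume)
    (hl : MemLp l q' volume) (hl' : MemLp l r' volume) :
    conv (conv f k) l = conv (conv f l) k := by
  funext x
  rw [conv_def, conv_def, integral_convolution_mul h hr' hf hk (memLp_sub_left hl' x),
    integral_convolution_mul h' hs' hf hl (memLp_sub_left hk' x)]
  congr 1 with y
  congr 1
  rw [← integral_sub_left_eq_self (fun z => l (z - y) * k (x - z)) volume (x + y)]
  congr 1 with z
  rw [mul_comm]
  congr 2 <;> ring

/-- A function with a Fourier transform that vanishes outside of `Ω` is band-limited after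
convolution with a Schwartz function. -/
theorem conv_schwartz_reproduced {Ω : Set ℝ} (hΩ : MeasurableSet Ω) (hfin : volume Ω ≠ ⊤)
    {p : Exponent} (hp : (p : ℝ≥0∞) ≤ 2) {f g : ℝ → ℂ} (hf : MemLp f p volume)
    (hfg : IsFourierTransform f g) (hg : ∀ᵐ ξ, ξ ∉ Ω → g ξ = 0) (ψ : 𝓢(ℝ, ℂ)) :
    conv (conv f ψ) (pwKernel Ω) =ᵐ[volume] conv f ψ := by
  obtain ⟨q, hq⟩ := exists_youngTriple_two hp
  have hF : MemLp (conv f ψ) 2 volume := memLp_convolution hq hf (ψ.memLp q volume)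
  have hco := hF.coeFn_toLp
  have hFT := isFourierTransform_Lp (hF.toLp _)
  have hη := (hfg.2 (𝓕 ψ)).1
  -- The convolution theorem 𝓕(f * ψ) = 𝓕ψ · g, tested against φ: ψ is moved onto 𝓕φ, which gives
  -- 𝓕(φ · 𝓕ψ), and the definition of g applies to φ · 𝓕ψ.
  have key : (𝓕 (hF.toLp _) : Lp ℂ 2 (volume : Measure ℝ)) =ᵐ[volume]
      fun ξ => (𝓕 ψ : 𝓢(ℝ, ℂ)) ξ * g ξ := by
    refine ae_eq_of_forall_schwartz hFT.1 hη.locallyIntegrable fun φ => ?_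
    rw [← (hFT.2 φ).2]
    have e1 : ∫ x, 𝓕 φ x * (hF.toLp _ : Lp ℂ 2 (volume : Measure ℝ)) x
        = ∫ x, conv f ψ x * (𝓕 φ : 𝓢(ℝ, ℂ)) x := by
      refine integral_congr_ae ?_
      filter_upwards [hco] with x hx
      rw [hx, mul_comm, fourier_coe]
    have e2 := (hfg.2 (pairing (ContinuousLinearMap.mul ℂ ℂ) φ (𝓕 ψ))).2
    rw [e1, integral_convolution_mul (r' := 2) hq (by norm_num) hf (ψ.memLp q volume)
      ((𝓕 φ : 𝓢(ℝ, ℂ)).memLp 2 volume)]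
    simp only [integral_sub_mul_fourier]
    simpa only [mul_comm (f _), pairing_apply_apply, ContinuousLinearMap.mul_apply',
      mul_assoc] using e2
  have hmem : hF.toLp _ ∈ PWHilbert Ω := by
    change ∀ᵐ ξ, ξ ∉ Ω → (𝓕 (hF.toLp _) : Lp ℂ 2 (volume : Measure ℝ)) ξ = 0
    filter_upwards [key, hg] with ξ h1 h2 hξ
    rw [h1, h2 hξ, mul_zero]
  have := (conv_pwKernel_ae_eq_iff hΩ hfin _).2 hmem
  rw [conv_congr_left hco] at this
  exact this.trans hco

/-- For p < 2, f is not known to be in `L_2`, so reproduction is proved for f * ψ and transferred to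
f by letting ψ range over reflected test functions. -/
theorem conv_pwKernel_eq_of_isFourierTransform {Ω : Set ℝ} (hΩ : MeasurableSet Ω)
    (hfin : volume Ω ≠ ⊤) (hK : ∀ p : Exponent, MemLp (pwKernel Ω) p volume)
    {p : Exponent} (hp : (p : ℝ≥0∞) ≤ 2) {f g : ℝ → ℂ} (hf : MemLp f p volume)
    (hfg : IsFourierTransform f g) (hg : ∀ᵐ ξ, ξ ∉ Ω → g ξ = 0) :
    conv f (pwKernel Ω) =ᵐ[volume] f := by
  obtain ⟨r, hpr⟩ := p.exists_gt
  obtain ⟨r', hr'⟩ := r.exists_conj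
  obtain ⟨q', hq'⟩ := Exponent.exists_young hpr
  obtain ⟨q, hq⟩ := exists_youngTriple_two hp
  have hc := memLp_conv_pwKernel hK hf hpr
  have hloc := hc.locallyIntegrable r.2.1.le
  have hlocf := hf.locallyIntegrable p.2.1.le
  refine ae_eq_of_integral_contDiff_smul_eq hloc hlocf fun θ hθ hθc => ?_
  have h1 : HasCompactSupport fun x => (θ (-x) : ℂ) :=
    (hθc.comp_homeomorph (Homeomorph.neg ℝ)).comp_left Complex.ofReal_zero
  have h2 : ContDiff ℝ ((⊤ : ℕ∞) : WithTop ℕ∞) fun x => (θ (-x) : ℂ) :=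
    Complex.ofRealCLM.contDiff.comp (hθ.comp contDiff_neg)
  set ψ : 𝓢(ℝ, ℂ) := h1.toSchwartzMap h2 with hψ
  have hψx : ∀ x, ψ x = (θ (-x) : ℂ) := fun x => rfl
  have hψc : HasCompactSupport ψ := h1
  have hcomm : conv (conv f ψ) (pwKernel Ω) = conv (conv f (pwKernel Ω)) ψ :=
    conv_conv_comm (r' := 2) (s' := r') hq hq' (by norm_num) r'.2.2.ne hf (ψ.memLp q volume)
      (ψ.memLp r' volume) (hK q') (hK ⟨2, by norm_num, by norm_num⟩)
  have hae := conv_schwartz_reproduced hΩ hfin hp hf hfg hg ψ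
  rw [hcomm] at hae
  -- Both convolutions with ψ are continuous, so they agree everywhere; at 0 they are the integrals
  -- of f * K and f against θ.
  have heq := (Continuous.ae_eq_iff_eq volume
    (hψc.continuous_convolution_right _ hloc ψ.continuous)
    (hψc.continuous_convolution_right _ hlocf ψ.continuous)).1 hae
  have h0 := congrFun heq 0
  change conv _ _ 0 = conv _ _ 0 at h0
  simpa only [conv_def, hψx, zero_sub, neg_neg, mul_comm, Complex.real_smul] using h0

/-- For p < 2, f = f * K is in `L_2` by the gain of integrability, so its Fourier transform is the
`L_2` one; the converse is the mollification argument. -/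
theorem reproducingSpace_eq_paleyWiener {Ω : Set ℝ} (hΩ : MeasurableSet Ω)
    (hfin : volume Ω ≠ ⊤) (hK : ∀ p : Exponent, MemLp (pwKernel Ω) p volume)
    {p : Exponent} (hp : (p : ℝ≥0∞) ≤ 2) :
    reproducingSpace (pwKernel Ω) p = paleyWiener Ω p := by
  ext f
  constructor
  · rintro ⟨hf, hr⟩
    have hrep := hr.2
    have h2 : MemLp f 2 volume := by
      rcases hp.eq_or_lt with h | h
      · exact h ▸ hf
      · exact (memLp_congr_ae hrep).1
          (memLp_conv_pwKernel hK (r := ⟨2, by norm_num, by norm_num⟩) hf h)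
    have hco := h2.coeFn_toLp
    refine ⟨hf, _, (isFourierTransform_Lp (h2.toLp f)).congr_left hco.symm, ?_⟩
    have hmem : h2.toLp f ∈ PWHilbert Ω := by
      rw [← conv_pwKernel_ae_eq_iff hΩ hfin, conv_congr_left hco]
      exact hrep.trans hco.symm
    exact hmem
  · rintro ⟨hf, g, hfg, hg⟩
    exact ⟨hf, (reproduced_iff hK hf).2
      (conv_pwKernel_eq_of_isFourierTransform hΩ hfin hK hp hf hfg hg)⟩

/-! ### The identification of the antidual -/

theorem exists_memLp_of_mem_reproducingUnion {K : ℝ → ℂ} (f : reproducingUnion K) :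
    ∃ p : Exponent, MemLp f.1 p volume := by
  obtain ⟨p, hp⟩ := Set.mem_iUnion.1 f.2
  exact ⟨p, hp.1⟩

theorem reproduced_of_mem_reproducingUnion {K : ℝ → ℂ} (f : reproducingUnion K) :
    Reproduced K f.1 := by
  obtain ⟨p, hp⟩ := Set.mem_iUnion.1 f.2
  exact hp.2

theorem bijective_functional {Ω : Set ℝ} (hΩ : MeasurableSet Ω) (hfin : volume Ω ≠ ⊤)
    (hK : ∀ p : Exponent, MemLp (pwKernel Ω) p volume) :
    Function.Bijective fun f : reproducingUnion (pwKernel Ω) =>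
      functional hΩ hfin f.1 (exists_memLp_of_mem_reproducingUnion f) := by
  constructor
  · intro f g hfg
    have h := congrArg (extVoice (pw_admissible hΩ hfin hK)) hfg
    simp only [extVoice_functional] at h
    refine Subtype.ext (AEEqFun.ext ?_)
    refine (reproduced_of_mem_reproducingUnion f).2.symm.trans ?_
    exact (Filter.EventuallyEq.of_eq h).trans (reproduced_of_mem_reproducingUnion g).2
  · intro T
    obtain ⟨f, ⟨p, hp⟩, hrep, hT⟩ := exists_eq_functional hK T
    have hco := AEEqFun.coeFn_mk f hp.1
    have hp' : MemLp (AEEqFun.mk f hp.1) p volume := (memLp_congr_ae hco).2 hp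
    refine ⟨⟨AEEqFun.mk f hp.1, Set.mem_iUnion.2 ⟨p, hp', (reproduced_iff hK hp').2 ?_⟩⟩, ?_⟩
    · rw [conv_congr_left hco]
      exact hrep.trans hco.symm
    · rw [← hT]
      ext v
      refine integral_congr_ae ?_
      filter_upwards [hco] with x hx
      rw [hx]

end Coorbit

/-! ### Coorbit spaces of the Paley-Wiener representation -/

theorem lemma5 (Ω : Set ℝ) (hΩ : MeasurableSet Ω) (hfin : volume Ω ≠ ⊤)
    (hK : ∀ p : Coorbit.Exponent, MemLp (Coorbit.pwKernel Ω) p volume) :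
    -- the test space, as a set and with its topology
    Set.range (fun g : Coorbit.PWTest hΩ hfin => Coorbit.PWTest.fn g)
        = {f | f ∈ Coorbit.targetSpace ∧ Coorbit.Reproduced (Coorbit.pwKernel Ω) f} ∧
    (∃ q : SeminormFamily ℂ (Coorbit.PWTest hΩ hfin) Coorbit.Exponent,
      (∀ p g, q p g = (eLpNorm (Coorbit.PWTest.fn g) p volume).toReal) ∧ WithSeminorms q) ∧
    -- the bijection between `M` and `S'`
    (∃ ι : Coorbit.reproducingUnion (Coorbit.pwKernel Ω) ≃
        Coorbit.AntiDual (Coorbit.translation Ω) (Coorbit.pwVector hΩ hfin),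
      (∀ f g, Integrable (fun x => f.1 x * conj (Coorbit.PWTest.fn g x)) volume ∧
        ι f g = ∫ x, f.1 x * conj (Coorbit.PWTest.fn g x)) ∧
      -- the extended voice transform is the identity
      (∀ φ, Coorbit.extVoice (Coorbit.pw_admissible hΩ hfin hK) φ =ᵐ[volume] (ι.symm φ).1) ∧
      -- the coorbit spaces and their norms
      (∀ p : Coorbit.Exponent,
        Coorbit.coorbit (Coorbit.pw_admissible hΩ hfin hK) p
            = ι '' {f | f.1 ∈ Coorbit.reproducingSpace (Coorbit.pwKernel Ω) p} ∧
        ∀ f, f.1 ∈ Coorbit.reproducingSpace (Coorbit.pwKernel Ω) p →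
          Coorbit.coorbitNorm (Coorbit.pw_admissible hΩ hfin hK) p (ι f)
            = (eLpNorm f.1 p volume).toReal)) ∧
    -- the Paley-Wiener spaces
    (∀ p : Coorbit.Exponent, (p : ℝ≥0∞) ≤ 2 →
      Coorbit.reproducingSpace (Coorbit.pwKernel Ω) p = Coorbit.paleyWiener Ω p) := by
  refine ⟨Coorbit.range_fn hΩ hfin hK, ⟨_, fun p g => Coorbit.testSeminorm_eq p g,
    Coorbit.withSeminorms_testSeminorm hΩ hfin⟩, ?_,
    fun p hp => Coorbit.reproducingSpace_eq_paleyWiener hΩ hfin hK hp⟩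
  let ι := Equiv.ofBijective _ (Coorbit.bijective_functional hΩ hfin hK)
  have hvoice : ∀ f, Coorbit.extVoice (Coorbit.pw_admissible hΩ hfin hK) (ι f)
      =ᵐ[volume] f.1 := by
    intro f
    refine (Filter.EventuallyEq.of_eq (Coorbit.extVoice_functional _ _ _)).trans ?_
    exact (Coorbit.reproduced_of_mem_reproducingUnion f).2
  refine ⟨ι, fun f g => ⟨?_, rfl⟩, fun φ => ?_, fun p => ⟨?_, fun f _ => ?_⟩⟩
  · obtain ⟨p, hp⟩ := Coorbit.exists_memLp_of_mem_reproducingUnion f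
    obtain ⟨q, hq⟩ := p.exists_conj
    exact Coorbit.integrable_mul_conj hp (Coorbit.PWTest.memLp g q)
  · have h := hvoice (ι.symm φ)
    rwa [ι.apply_symm_apply] at h
  · ext φ
    constructor
    · intro h
      have h1 := hvoice (ι.symm φ)
      rw [ι.apply_symm_apply] at h1
      -- The function behind φ may come from another exponent in the union; it equals the extended
      -- voice transform of φ, so it is in `L_p` and, being reproduced, in M_p.
      exact ⟨ι.symm φ, ⟨(memLp_congr_ae h1).1 h,
        Coorbit.reproduced_of_mem_reproducingUnion _⟩, ι.apply_symm_apply φ⟩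
    · rintro ⟨f, hf, rfl⟩
      exact (memLp_congr_ae (hvoice f)).2 hf.1
  · exact congrArg ENNReal.toReal (eLpNorm_congr_ae (hvoice f))
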